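/- Let $H$ be a complex Hilbert space and let $$A=\sum_{n\ge 1}s_nP_n ,$$ where $s_n\in\mathbb C\setminus\{0\}$, $s_n\to0$, and the $P_n$ are finite-rank orthogonal projections in $H$ with $P_nP_m=0$ for $n\ne m$ and $\sum_nP_n=I$; so $A$ is a compact normal operator with trivial kernel. Assume that $A$ belongs to a Schatten class $\mathfrak S_p$, $0<p<\infty$, and that its spectrum is contained in a finite union of rays $\arg z=\alpha_\ell$, $1\le\ell\le m$ (the vertex $0$ being included in the rays). Let $a,b\in H$ and $$Lx=Ax+\langle x,b\rangle a,\qquad x\in H.$$ Assume that, for some integer $k\ge1$, $$\sum_n|s_n|^{-k}\,|\langle P_na,b\rangle|<\infty ,$$ but the equality $$(\mathrm M_k)\qquad \sum_n s_n^{-k}\langle P_na,b\rangle=\begin{cases}-1,&k=1,\\ 0,&k\ge2,\end{cases}$$ does not hold. Then: 1. $L$ and $L^*$ are nearly complete, where a compact operator $T$ on $H$ is called nearly complete if the closed linear span of its root vectors (the elements of $\bigcup_{j\ge1}\ker(T-\lambda I)^j$) corresponding to non-zero eigenvalues $\lambda$ has finite codimension in $H$. 2. For every $\varepsilon>0$ there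 is $r>0$ such that every $z\in\sigma(L)\setminus\{0\}$ with $|z|<r$ lies in the union of the angles $\alpha_\ell-\varepsilon<\arg z<\alpha_\ell+\varepsilon$, $1\le\ell\le m$ (arguments being taken modulo $2\pi$). -/

import Mathlib

open Filter Topology

noncomputable section

variable {H : Type*} [NormedAddCommGroup H] [InnerProductSpace ℂ H] [CompleteSpace H]

/-- The closed linear span `M(T)` of the root vectors of `T` (the vectors in
`⋃ j, ker (T - μ) ^ j`) corresponding to its non-zero eigenvalues `μ`. -/
def rootSpan (T : H →L[ℂ] H) : Submodule ℂ H :=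
  (⨆ μ : {μ : ℂ // μ ≠ 0},
    Module.End.maxGenEigenspace (T : H →ₗ[ℂ] H) (μ : ℂ)).topologicalClosure

/-- `T` is nearly complete: `M(T)` has finite codimension in `H`. -/
def NearlyComplete (T : H →L[ℂ] H) : Prop :=
  FiniteDimensional ℂ (H ⧸ rootSpan T)

/-- The multiplicity of `σ > 0` as a singular number of `T`: the dimension of
`ker (T* T - σ²)`. -/
def singularMultiplicity (T : H →L[ℂ] H) (σ : ℝ) : ℕ :=
  Module.finrank ℂ
    (Module.End.eigenspace ((ContinuousLinearMap.adjoint T ∘L T : H →L[ℂ] H) : H →ₗ[ℂ] H)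
      ((σ : ℂ) ^ 2))

/-- The Schatten class with exponent `p`: compact operators whose non-zero singular numbers,
counted with multiplicity, are `p`-summable. -/
def MemSchatten (p : ℝ) (T : H →L[ℂ] H) : Prop :=
  IsCompactOperator T ∧
    Summable fun σ : {σ : ℝ // 0 < σ} => (singularMultiplicity T σ : ℝ) * (σ : ℝ) ^ p

/-- `A = ∑ n, s n • P n`, where `s n ≠ 0`, `s n → 0`, and the `P n` are mutually orthogonal
orthogonal projections of finite rank with `∑ n, P n = 1`. -/
structure IsSpectralDecomposition (A : H →L[ℂ] H) (s : ℕ → ℂ) (P : ℕ → H →L[ℂ] H) : Prop where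
  ne_zero : ∀ n, s n ≠ 0
  tendsto_zero : Tendsto s atTop (𝓝 0)
  isStarProjection : ∀ n, IsStarProjection (P n)
  finiteDimensional_range : ∀ n, FiniteDimensional ℂ (LinearMap.range (P n : H →ₗ[ℂ] H))
  orthogonal : ∀ m n, m ≠ n → P m ∘L P n = 0
  hasSum_id : ∀ x, HasSum (fun n => P n x) x
  hasSum_apply : ∀ x, HasSum (fun n => s n • P n x) (A x)

/-- The one-dimensional perturbation `x ↦ A x + ⟨x, b⟩ a`. Here `⟨x, b⟩`, linear in `x`,
is `inner ℂ b x`. -/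
def rankOnePerturbation (A : H →L[ℂ] H) (a b : H) : H →L[ℂ] H :=
  A + (innerSL ℂ b).smulRight a

/-- The moment equation `(M_k)`, `k ≥ 1`: the sum of `(s n)⁻ᵏ ⟨P n a, b⟩` over `n` equals `-1`
if `k = 1`, and `0` if `k ≥ 2`. -/
def MomentEquation (s : ℕ → ℂ) (P : ℕ → H →L[ℂ] H) (a b : H) (k : ℕ) : Prop :=
  HasSum (fun n => s n ^ (-(k : ℤ)) * inner ℂ b (P n a)) (if k = 1 then -1 else 0)

/-- The closed ray `arg z = α` (with its vertex `0`). -/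
def closedRay (α : ℝ) : Set ℂ :=
  {z | ∃ ρ : ℝ, 0 ≤ ρ ∧ z = ρ * Complex.exp (α * Complex.I)}

/-- The open angle `α - ε < arg z < α + ε`, the argument being understood modulo `2π`. -/
def openAngle (α ε : ℝ) : Set ℂ :=
  {z | ∃ ρ θ : ℝ, 0 < ρ ∧ α - ε < θ ∧ θ < α + ε ∧ z = ρ * Complex.exp (θ * Complex.I)}

end

/-!
Write `L = A + ⟨·, b⟩ a`, `d n = ⟨P n a, b⟩`. Everything rests on the perturbation determinant
`1 + ∑ d n / (s n - z)`, whose zeros away from the `s n` are the eigenvalues of `L`. If the least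
moment equation that fails has index `j + 1 ≤ k`, expanding `1 / (s n - z)` in powers of `z` shows
that the determinant is `c z ^ j (1 + o(1))`, `c ≠ 0`, as `z → 0` away from the rays
(`exists_tendsto_perturbationDet_div_pow`). By the Fredholm alternative this confines the small
eigenvalues of `L` to narrow angles about the rays
(`IsDiagonalizedBy.exists_spectrum_inter_ball_subset`).

For completeness, let `K` be the orthogonal complement of the root vectors of a compact operator
whose adjoint `T` is such a perturbation. Then `K` is invariant under `T`, and `T` is quasinilpotent
on `K` (`IsCompactOperator.isUnit_one_sub_smul_restrict_adjoint`), because compact operators have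
finite ascent. So for `h ∈ K` and any `g` the function `F w = ⟨(1 - w T)⁻¹ T ^ N h, g⟩` is entire.
It is expressed explicitly through Cauchy-type series `∑ c n / (1 - w s n)` with summable `c`,
divided by the determinant `Δ` in the variable `w = 1 / z`.

* The Cauchy-type series are bounded on each ray of direction `θ` by a constant over
  `δ θ = ∏ |sin (θ + α l)|`, and `log δ` is integrable. Moreover `Δ` becomes analytic on a disc of
  radius `R` when multiplied by a finite product of order `p`, so Jensen's formula bounds the mean
  of `log⁻ ‖Δ‖` over the circle. Together this bounds the circle means of `log⁺ ‖F‖` by a power of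
  `R` (`exists_circleAverage_posLog_norm_le`); as `log⁺ ‖F‖` is subharmonic, `F` has finite order
  (`Differentiable.norm_le_exp_of_circleAverage_posLog_le`).
* By the asymptotics of `Δ`, if `N = j + 1` then `F` is bounded on every ray with `δ θ ≠ 0`
  (`exists_norm_le_pow_on_ray`). The directions of these rays are dense, so Phragmén–Lindelöf and
  Liouville make `F` constant (`Differentiable.eq_const_of_bounded_on_dense_rays`).

Hence `T ^ (N + 1) = 0` on `K`. Since `A` is injective, `ker T` is at most one-dimensional, and `K`
is finite-dimensional (`IsDiagonalizedBy.finiteDimensional_of_quasinilpotent`). The hypotheses are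
invariant under passing to adjoints, which yields both `L` and `L†`.
-/

noncomputable section

/-! ### Entire functions of finite order -/

/-- The sub-mean value property of `log ‖f‖` for analytic `f`, a consequence of Jensen's formula. -/
theorem AnalyticOnNhd.log_norm_le_circleAverage {f : ℂ → ℂ} {c : ℂ} {R : ℝ} (hR : 0 < R)
    (hf : AnalyticOnNhd ℂ f (Metric.closedBall c R)) (hc : f c ≠ 0) :
    Real.log ‖f c‖ ≤ Real.circleAverage (Real.log ‖f ·‖) c R := by
  have hf' : AnalyticOnNhd ℂ f (Metric.closedBall c |R|) := by rwa [abs_of_pos hR]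
  rw [AnalyticOnNhd.circleAverage_log_norm hR.ne' hf' hc]
  refine le_add_of_nonneg_left (finsum_nonneg fun u => ?_)
  by_cases hu : u ∈ Metric.closedBall c |R|
  · refine mul_nonneg ?_ ?_
    · exact_mod_cast (MeromorphicOn.AnalyticOnNhd.divisor_nonneg hf') u
    · rcases eq_or_ne c u with rfl | hne
      · simp
      · apply Real.log_nonneg
        rw [abs_of_pos hR, mem_closedBall_iff_norm'] at hu
        have : 0 < ‖c - u‖ := norm_pos_iff.2 (sub_ne_zero.2 hne)
        rw [← div_eq_mul_inv, one_le_div this]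
        exact hu
  · simp [Function.locallyFinsuppWithin.apply_eq_zero_of_notMem _ hu]

open Real in
/-- `log⁺ ‖F‖` is subharmonic for entire `F`. -/
theorem Differentiable.posLog_norm_le_circleAverage {F : ℂ → ℂ} (hF : Differentiable ℂ F)
    (c : ℂ) {R : ℝ} (hR : 0 < R) :
    log⁺ ‖F c‖ ≤ Real.circleAverage (fun z => log⁺ ‖F z‖) c R := by
  have hcont : Continuous fun z => log⁺ ‖F z‖ := Real.continuous_posLog.comp hF.continuous.norm
  have hnn : 0 ≤ Real.circleAverage (fun z => log⁺ ‖F z‖) c R :=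
    Real.circleAverage_nonneg_of_nonneg fun _ _ => Real.posLog_nonneg
  rw [Real.posLog_apply]
  refine max_le hnn ?_
  by_cases h0 : F c = 0
  · simpa [h0] using hnn
  have hF' : AnalyticOnNhd ℂ F Set.univ := fun z _ => hF.analyticAt z
  refine ((hF'.mono (Set.subset_univ _)).log_norm_le_circleAverage hR h0).trans ?_
  refine Real.circleAverage_mono ?_ ?_ fun x _ => ?_
  · exact MeromorphicOn.circleIntegrable_log_norm fun x _ => (hF.analyticAt x).meromorphicAt
  · exact (hcont.continuousOn).circleIntegrable'
  · rw [Real.posLog_apply]; exact le_max_right _ _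

/-- Polar coordinates around an arbitrary centre. -/
theorem lintegral_ball_eq_lintegral_circleAverage {u : ℂ → ℝ} (hu : Continuous u)
    (h0 : ∀ z, 0 ≤ u z) (c : ℂ) (r : ℝ) :
    ∫⁻ z in Metric.ball c r, ENNReal.ofReal (u z) =
      ∫⁻ ρ in Set.Ioo 0 r, ENNReal.ofReal (2 * Real.pi * ρ * Real.circleAverage u c ρ) := by
  have key (ρ : ℝ) : ∫⁻ θ in Set.Ioo (-Real.pi) Real.pi, ENNReal.ofReal (u (circleMap c ρ θ))
      = ENNReal.ofReal (2 * Real.pi * Real.circleAverage u c ρ) := by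
    have hc : Continuous fun θ : ℝ => u (circleMap c ρ θ) := hu.comp (continuous_circleMap c ρ)
    rw [Real.circleAverage_eq_integral_add (-Real.pi),
      intervalIntegral.integral_comp_add_right (fun θ => u (circleMap c ρ θ)),
      intervalIntegral.integral_of_le (by linarith [Real.pi_pos]),
      smul_eq_mul, ← mul_assoc, mul_inv_cancel₀ (by positivity), one_mul,
      MeasureTheory.integral_Ioc_eq_integral_Ioo,
      show 0 + -Real.pi = -Real.pi by ring, show 2 * Real.pi + -Real.pi = Real.pi by ring,
      MeasureTheory.ofReal_integral_eq_lintegral_ofReal]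
    · exact (hc.integrableOn_Icc (a := -Real.pi) (b := Real.pi)).mono_set Set.Ioo_subset_Icc_self
    · exact Eventually.of_forall fun θ => h0 _
  calc ∫⁻ z in Metric.ball c r, ENNReal.ofReal (u z)
      = ∫⁻ z, (Metric.ball c r).indicator (fun z => ENNReal.ofReal (u z)) z := by
        rw [MeasureTheory.lintegral_indicator Metric.isOpen_ball.measurableSet]
    _ = ∫⁻ z, (Metric.ball c r).indicator (fun z => ENNReal.ofReal (u z)) (c + z) :=
        (MeasureTheory.lintegral_add_left_eq_self _ c).symm
    _ = ∫⁻ p in Set.Ioi (0 : ℝ) ×ˢ Set.Ioo (-Real.pi) Real.pi,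
          (Set.Ioo 0 r).indicator (fun ρ => ENNReal.ofReal ρ) p.1 *
            ENNReal.ofReal (u (circleMap c p.1 p.2)) := by
        rw [← Complex.lintegral_comp_polarCoord_symm]
        refine MeasureTheory.setLIntegral_congr_fun
          (measurableSet_Ioi.prod measurableSet_Ioo) fun p hp => ?_
        have hp0 : 0 < p.1 := hp.1
        have hz : c + Complex.polarCoord.symm p = circleMap c p.1 p.2 := by
          rw [Complex.polarCoord_symm_apply, circleMap, Complex.exp_mul_I]
          push_cast; ring
        have hmem : circleMap c p.1 p.2 ∈ Metric.ball c r ↔ p.1 ∈ Set.Ioo 0 r := by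
          simp [circleMap, abs_of_pos hp0, hp0]
        simp only [hz, smul_eq_mul]
        by_cases h : p.1 ∈ Set.Ioo 0 r
        · rw [Set.indicator_of_mem (hmem.2 h), Set.indicator_of_mem h]
        · rw [Set.indicator_of_notMem (fun h' => h (hmem.1 h')), Set.indicator_of_notMem h]
          simp
    _ = ∫⁻ ρ in Set.Ioi (0 : ℝ), (Set.Ioo 0 r).indicator (fun ρ => ENNReal.ofReal ρ) ρ *
          ENNReal.ofReal (2 * Real.pi * Real.circleAverage u c ρ) := by
        rw [MeasureTheory.Measure.volume_eq_prod, MeasureTheory.setLIntegral_prod]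
        · refine MeasureTheory.lintegral_congr fun ρ => ?_
          have hm : Measurable fun θ => ENNReal.ofReal (u (circleMap c ρ θ)) :=
            (hu.comp (continuous_circleMap c ρ)).measurable.ennreal_ofReal
          dsimp only
          rw [MeasureTheory.lintegral_const_mul _ hm, key]
        · refine (Measurable.mul ?_ ?_).aemeasurable
          · exact (ENNReal.measurable_ofReal.indicator measurableSet_Ioo).comp measurable_fst
          · have : Continuous fun p : ℝ × ℝ => u (circleMap c p.1 p.2) := by
              unfold circleMap; fun_prop
            exact this.measurable.ennreal_ofReal
    _ = ∫⁻ ρ in Set.Ioi (0 : ℝ), (Set.Ioo 0 r).indicator (fun ρ =>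
          ENNReal.ofReal (2 * Real.pi * ρ * Real.circleAverage u c ρ)) ρ := by
        refine MeasureTheory.lintegral_congr fun ρ => ?_
        by_cases h : ρ ∈ Set.Ioo 0 r
        · rw [Set.indicator_of_mem h, Set.indicator_of_mem h, ← ENNReal.ofReal_mul h.1.le]
          congr 1; ring
        · simp [Set.indicator_of_notMem h]
    _ = _ := by
        rw [MeasureTheory.setLIntegral_indicator measurableSet_Ioo]
        congr 2
        ext x; simp +contextual

/-- If a nonnegative continuous function satisfies the sub-mean value property, its value at `z`
is controlled by its mean over circles around `0`: compare the area means over the discs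
`B(z, ‖z‖) ⊆ B(0, 2‖z‖)`. -/
theorem le_four_mul_of_circleAverage_le {u : ℂ → ℝ} (hu : Continuous u) (h0 : ∀ z, 0 ≤ u z)
    (hsub : ∀ c R, 0 < R → u c ≤ Real.circleAverage u c R) {z : ℂ} (hz : z ≠ 0) {M : ℝ}
    (hM : ∀ R, 0 < R → R < 2 * ‖z‖ → Real.circleAverage u 0 R ≤ M) : u z ≤ 4 * M := by
  have hz' : 0 < ‖z‖ := norm_pos_iff.2 hz
  have hM0 : 0 ≤ M :=
    (Real.circleAverage_nonneg_of_nonneg fun _ _ => h0 _).trans (hM ‖z‖ hz' (by linarith))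
  have hconst (c : ℂ) (r K : ℝ) (hr : 0 < r) (hK : 0 ≤ K) :
      ∫⁻ ρ in Set.Ioo 0 r, ENNReal.ofReal (2 * Real.pi * ρ * K) =
        ENNReal.ofReal K * MeasureTheory.volume (Metric.ball c r) := by
    have := lintegral_ball_eq_lintegral_circleAverage (u := fun _ => K) continuous_const
      (fun _ => hK) c r
    simp only [Real.circleAverage_const] at this
    rw [← this, MeasureTheory.setLIntegral_const]
  have h1 : ENNReal.ofReal (u z) * MeasureTheory.volume (Metric.ball z ‖z‖) ≤
      ENNReal.ofReal M * MeasureTheory.volume (Metric.ball (0 : ℂ) (2 * ‖z‖)) := by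
    calc _ = ∫⁻ ρ in Set.Ioo 0 ‖z‖, ENNReal.ofReal (2 * Real.pi * ρ * u z) :=
          (hconst z _ _ hz' (h0 z)).symm
      _ ≤ ∫⁻ ρ in Set.Ioo 0 ‖z‖, ENNReal.ofReal (2 * Real.pi * ρ * Real.circleAverage u z ρ) := by
          refine MeasureTheory.setLIntegral_mono' measurableSet_Ioo fun ρ hρ => ?_
          have := hρ.1
          exact ENNReal.ofReal_le_ofReal (by gcongr; exact hsub z ρ hρ.1)
      _ = ∫⁻ w in Metric.ball z ‖z‖, ENNReal.ofReal (u w) :=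
          (lintegral_ball_eq_lintegral_circleAverage hu h0 _ _).symm
      _ ≤ ∫⁻ w in Metric.ball 0 (2 * ‖z‖), ENNReal.ofReal (u w) := by
          refine MeasureTheory.lintegral_mono_set (Metric.ball_subset_ball' ?_)
          rw [dist_zero_right]; linarith
      _ = ∫⁻ ρ in Set.Ioo 0 (2 * ‖z‖),
            ENNReal.ofReal (2 * Real.pi * ρ * Real.circleAverage u 0 ρ) :=
          lintegral_ball_eq_lintegral_circleAverage hu h0 _ _
      _ ≤ ∫⁻ ρ in Set.Ioo 0 (2 * ‖z‖), ENNReal.ofReal (2 * Real.pi * ρ * M) := by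
          refine MeasureTheory.setLIntegral_mono' measurableSet_Ioo fun ρ hρ => ?_
          have := hρ.1
          exact ENNReal.ofReal_le_ofReal (by gcongr; exact hM ρ hρ.1 hρ.2)
      _ = _ := hconst 0 _ _ (by positivity) hM0
  rw [Complex.volume_ball, Complex.volume_ball, ← ENNReal.ofReal_pow hz'.le,
    ← ENNReal.ofReal_pow (by positivity), ← mul_assoc, ← mul_assoc,
    ENNReal.mul_le_mul_iff_left (by simpa using NNReal.pi_ne_zero) (by simp),
    ← ENNReal.ofReal_mul (h0 z), ← ENNReal.ofReal_mul hM0,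
    ENNReal.ofReal_le_ofReal_iff (by positivity)] at h1
  have h2 : ‖z‖ ^ 2 * u z ≤ ‖z‖ ^ 2 * (4 * M) := by linarith
  exact le_of_mul_le_mul_left h2 (by positivity)

open Real in
/-- An entire function whose proximity function grows polynomially has finite order. -/
theorem Differentiable.norm_le_exp_of_circleAverage_posLog_le {F : ℂ → ℂ}
    (hF : Differentiable ℂ F) {C q : ℝ} (hC : 0 ≤ C) (hq : 0 ≤ q)
    (h : ∀ R, 0 < R → Real.circleAverage (fun z => log⁺ ‖F z‖) 0 R ≤ C * (1 + R) ^ q)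
    {z : ℂ} (hz : z ≠ 0) : ‖F z‖ ≤ Real.exp (4 * (C * (1 + 2 * ‖z‖) ^ q)) := by
  have hcont : Continuous fun z => log⁺ ‖F z‖ := Real.continuous_posLog.comp hF.continuous.norm
  have := le_four_mul_of_circleAverage_le hcont (fun _ => Real.posLog_nonneg)
    (fun c R hR => hF.posLog_norm_le_circleAverage c hR) hz (M := C * (1 + 2 * ‖z‖) ^ q)
    fun R hR hR' => (h R hR).trans (by gcongr)
  by_cases h0 : F z = 0
  · rw [h0, norm_zero]; exact (Real.exp_pos _).le
  rw [← Real.log_le_iff_le_exp (norm_pos_iff.2 h0)]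
  refine le_trans ?_ this
  rw [Real.posLog_apply]; exact le_max_right _ _

/-- The Phragmén–Lindelöf principle for a sector of small opening. -/
theorem Differentiable.norm_le_of_sector {F : ℂ → ℂ} (hF : Differentiable ℂ F) {C q : ℝ}
    (hC : 0 ≤ C) (hq : 0 ≤ q)
    (hgrowth : ∀ z, z ≠ 0 → ‖F z‖ ≤ Real.exp (C * (1 + 2 * ‖z‖) ^ q)) {θ₁ θ₂ M : ℝ}
    (hsmall : q < Real.pi / (θ₂ - θ₁))
    (h₁ : ∀ ρ : ℝ, 0 ≤ ρ → ‖F (ρ * Complex.exp (θ₁ * Complex.I))‖ ≤ M)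
    (h₂ : ∀ ρ : ℝ, 0 ≤ ρ → ‖F (ρ * Complex.exp (θ₂ * Complex.I))‖ ≤ M)
    {θ ρ : ℝ} (hθ : θ ∈ Set.Icc θ₁ θ₂) (hρ : 0 < ρ) :
    ‖F (ρ * Complex.exp (θ * Complex.I))‖ ≤ M := by
  have hexp (z : ℂ) : Complex.exp z = (Real.exp z.re : ℝ) * Complex.exp (z.im * Complex.I) := by
    rw [Complex.ofReal_exp, ← Complex.exp_add, Complex.re_add_im]
  have key := PhragmenLindelof.horizontal_strip (f := fun z => F (Complex.exp z)) (C := M)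
    (a := θ₁) (b := θ₂) (z := Real.log ρ + θ * Complex.I)
    (hF.comp Complex.differentiable_exp).diffContOnCl
    ⟨q, hsmall, C * 3 ^ q, ?_⟩ ?_ ?_ (by simpa using hθ.1) (by simpa using hθ.2)
  · rw [hexp] at key
    simpa [Real.exp_log hρ] using key
  · refine Asymptotics.IsBigO.of_bound 1 (Eventually.of_forall fun z => ?_)
    rw [Real.norm_of_nonneg (Real.exp_pos _).le, one_mul]
    refine (hgrowth _ (Complex.exp_ne_zero z)).trans ?_
    rw [Real.exp_le_exp, mul_assoc, mul_comm q, Real.exp_mul, ← Real.mul_rpow (by norm_num)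
      (Real.exp_pos _).le, Complex.norm_exp]
    have h1 : 1 ≤ Real.exp |z.re| := Real.one_le_exp (abs_nonneg _)
    have h2 : Real.exp z.re ≤ Real.exp |z.re| := Real.exp_le_exp.2 (le_abs_self _)
    gcongr
    linarith
  · intro z hz
    change ‖F (Complex.exp z)‖ ≤ M
    rw [hexp, hz]; exact h₁ _ (Real.exp_pos _).le
  · intro z hz
    change ‖F (Complex.exp z)‖ ≤ M
    rw [hexp, hz]; exact h₂ _ (Real.exp_pos _).le

/-- An entire function of finite order which is bounded on each ray of a set of rays with dense
directions is constant. -/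
theorem Differentiable.eq_const_of_bounded_on_dense_rays {F : ℂ → ℂ} (hF : Differentiable ℂ F)
    {C q : ℝ} (hC : 0 ≤ C) (hq : 0 ≤ q)
    (hgrowth : ∀ z, z ≠ 0 → ‖F z‖ ≤ Real.exp (C * (1 + 2 * ‖z‖) ^ q))
    (hray : Dense {θ : ℝ | ∃ M, ∀ ρ : ℝ, 0 ≤ ρ → ‖F (ρ * Complex.exp (θ * Complex.I))‖ ≤ M})
    (z : ℂ) : F z = F 0 := by
  have hq1 : 0 < q + 1 := by linarith
  set η := Real.pi / (2 * (q + 1)) with hη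
  have hη0 : 0 < η := by positivity
  -- Every direction lies in a sector of opening less than `π / (q + 1)` bounded by good rays.
  have hloc (θ₀ : ℝ) : ∃ U ∈ 𝓝 θ₀, ∃ M, ∀ θ ∈ U, ∀ ρ : ℝ, 0 < ρ →
      ‖F (ρ * Complex.exp (θ * Complex.I))‖ ≤ M := by
    obtain ⟨θ₁, ⟨M₁, hM₁⟩, h1⟩ := hray.exists_between (show θ₀ - η < θ₀ by linarith)
    obtain ⟨θ₂, ⟨M₂, hM₂⟩, h2⟩ := hray.exists_between (show θ₀ < θ₀ + η by linarith)
    refine ⟨Set.Icc θ₁ θ₂, Icc_mem_nhds h1.2 h2.1, max M₁ M₂, fun θ hθ ρ hρ => ?_⟩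
    refine hF.norm_le_of_sector hC hq hgrowth ?_
      (fun ρ hρ => (hM₁ ρ hρ).trans (le_max_left _ _))
      (fun ρ hρ => (hM₂ ρ hρ).trans (le_max_right _ _)) hθ hρ
    have hd : 0 < θ₂ - θ₁ := by linarith [h1.2, h2.1]
    have hd2 : θ₂ - θ₁ < 2 * η := by linarith [h1.1, h2.2]
    rw [lt_div_iff₀ hd]
    have : 2 * η * (q + 1) = Real.pi := by rw [hη]; field_simp
    nlinarith
  choose U hU M hM using hloc
  obtain ⟨t, -, ht⟩ := isCompact_Icc (a := -Real.pi) (b := Real.pi) |>.elim_nhds_subcover U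
    fun x _ => hU x
  refine hF.apply_eq_apply_of_bounded ?_ z 0
  have hb : ∃ K, ∀ x ∈ t, M x ≤ K := by
    obtain ⟨K, hK⟩ := (t.image M).bddAbove
    exact ⟨K, fun x hx => hK (by exact_mod_cast Finset.mem_image_of_mem _ hx)⟩
  obtain ⟨K, hK⟩ := hb
  refine (Metric.isBounded_closedBall (x := (0 : ℂ)) (r := max K ‖F 0‖)).subset ?_
  rintro _ ⟨w, rfl⟩
  rw [mem_closedBall_zero_iff]
  rcases eq_or_ne w 0 with rfl | hw
  · exact le_max_right _ _
  have harg : Complex.arg w ∈ Set.Icc (-Real.pi) Real.pi :=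
    ⟨(Complex.neg_pi_lt_arg w).le, Complex.arg_le_pi w⟩
  obtain ⟨x, hx, hxU⟩ := Set.mem_iUnion₂.1 (ht harg)
  have := hM x _ hxU ‖w‖ (norm_pos_iff.2 hw)
  rw [Complex.norm_mul_exp_arg_mul_I] at this
  exact this.trans ((hK x hx).trans (le_max_left _ _))

/-! ### Cauchy-type series and the circle means of matrix elements of the resolvent -/

/-- The Cauchy-type series `∑ n, c n / (1 - w s n)`. -/
def cauchySeries (s c : ℕ → ℂ) (w : ℂ) : ℂ := ∑' n, c n / (1 - w * s n)

/-- The perturbation determinant in the variable `w = 1 / z`. -/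
def perturbationDet (s d : ℕ → ℂ) (w : ℂ) : ℂ := 1 - w * cauchySeries s d w

/-- The product `∏ l, |sin (θ + α l)|`: a lower bound for the distance from `1` to the points
`w s n` when `arg w = θ` and the `s n` lie on the rays `arg z = α l`. -/
def sinProd {m : ℕ} (α : Fin m → ℝ) (θ : ℝ) : ℝ := ∏ l, |Real.sin (θ + α l)|

theorem abs_sin_le_norm_one_sub (x φ : ℝ) :
    |Real.sin φ| ≤ ‖1 - x * Complex.exp (φ * Complex.I)‖ := by
  have h : (1 - x * Complex.exp (φ * Complex.I)) =
      Complex.exp (φ * Complex.I) * (Complex.exp ((-φ : ℝ) * Complex.I) - x) := by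
    rw [mul_sub, ← Complex.exp_add]; push_cast; ring_nf; simp; ring
  rw [h, norm_mul, Complex.norm_exp_ofReal_mul_I, one_mul]
  refine le_trans (le_of_eq ?_) (Complex.abs_im_le_norm _)
  rw [Complex.sub_im, Complex.ofReal_im, Complex.exp_ofReal_mul_I_im, Real.sin_neg, sub_zero,
    abs_neg]

section Rays

variable {m : ℕ} {α : Fin m → ℝ} {s : ℕ → ℂ}

theorem sinProd_nonneg (α : Fin m → ℝ) (θ : ℝ) : 0 ≤ sinProd α θ :=
  Finset.prod_nonneg fun _ _ => abs_nonneg _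

theorem sinProd_le_one (α : Fin m → ℝ) (θ : ℝ) : sinProd α θ ≤ 1 :=
  Finset.prod_le_one (fun _ _ => abs_nonneg _) fun _ _ => Real.abs_sin_le_one _

theorem sinProd_le_abs_sin (α : Fin m → ℝ) (θ : ℝ) (l : Fin m) :
    sinProd α θ ≤ |Real.sin (θ + α l)| := by
  classical
  rw [sinProd, ← Finset.mul_prod_erase _ _ (Finset.mem_univ l)]
  exact mul_le_of_le_one_right (abs_nonneg _)
    (Finset.prod_le_one (fun _ _ => abs_nonneg _) fun _ _ => Real.abs_sin_le_one _)

theorem sinProd_le_norm_one_sub (hs : ∀ n, s n ≠ 0 → ∃ l, s n ∈ closedRay (α l)) (R θ : ℝ) (n : ℕ) :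
    sinProd α θ ≤ ‖1 - R * Complex.exp (θ * Complex.I) * s n‖ := by
  by_cases h0 : s n = 0
  · simpa [h0] using sinProd_le_one α θ
  obtain ⟨l, ρ, -, hρ⟩ := hs n h0
  refine (sinProd_le_abs_sin α θ l).trans ?_
  have h : (1 : ℂ) - R * Complex.exp (θ * Complex.I) * s n =
      1 - (R * ρ : ℝ) * Complex.exp ((θ + α l : ℝ) * Complex.I) := by
    rw [hρ]; push_cast
    rw [add_mul, Complex.exp_add]; ring
  rw [h]
  exact abs_sin_le_norm_one_sub _ _

theorem countable_setOf_sinProd_eq_zero (α : Fin m → ℝ) : {θ | sinProd α θ = 0}.Countable := by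
  refine (Set.countable_iUnion fun l : Fin m =>
    Set.countable_range fun k : ℤ => (k : ℝ) * Real.pi - α l).mono fun θ hθ => ?_
  obtain ⟨l, -, hl⟩ := Finset.prod_eq_zero_iff.1 hθ
  obtain ⟨k, hk⟩ := Real.sin_eq_zero_iff.1 (abs_eq_zero.1 hl)
  exact Set.mem_iUnion.2 ⟨l, k, by simp only; linarith⟩

theorem intervalIntegrable_log_sinProd (α : Fin m → ℝ) (a b : ℝ) :
    IntervalIntegrable (fun θ => Real.log (sinProd α θ)) MeasureTheory.volume a b := by
  refine (AnalyticOnNhd.meromorphicOn (f := fun θ => ∏ l, Real.sin (θ + α l))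
    fun θ _ => ?_).intervalIntegrable_log_norm.congr ?_
  · exact Finset.analyticAt_fun_prod _ fun l _ => by fun_prop
  · exact fun θ _ => by simp [sinProd]

/-- On the ray `arg w = θ` a Cauchy-type series is dominated by `1 / sinProd α θ`. -/
theorem norm_div_one_sub_le (hs : ∀ n, s n ≠ 0 → ∃ l, s n ∈ closedRay (α l)) (c : ℕ → ℂ) (R : ℝ)
    {θ : ℝ} (hθ : 0 < sinProd α θ) (n : ℕ) :
    ‖c n / (1 - R * Complex.exp (θ * Complex.I) * s n)‖ ≤ ‖c n‖ / sinProd α θ := by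
  rw [norm_div]
  exact div_le_div_of_nonneg_left (norm_nonneg _) hθ (sinProd_le_norm_one_sub hs R θ n)

theorem norm_cauchySeries_le (hs : ∀ n, s n ≠ 0 → ∃ l, s n ∈ closedRay (α l)) {c : ℕ → ℂ}
    (hc : Summable fun n => ‖c n‖) (R : ℝ) {θ : ℝ} (hθ : 0 < sinProd α θ) :
    ‖cauchySeries s c (R * Complex.exp (θ * Complex.I))‖ ≤ (∑' n, ‖c n‖) / sinProd α θ :=
  tsum_of_norm_bounded (hc.hasSum.div_const _) fun n => norm_div_one_sub_le hs c R hθ n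

end Rays

/-- `Δ` times a suitable finite product extends analytically across the poles of `Δ` in the disc of
radius `R`. -/
theorem exists_analytic_prod_mul_perturbationDet {s d : ℕ → ℂ} (hs0 : Tendsto s atTop (𝓝 0))
    (hd : Summable fun n => ‖d n‖) {R : ℝ} (hR : 0 < R) :
    ∃ I : Finset ℕ, (∀ n ∈ I, 1 / 2 ≤ R * ‖s n‖) ∧ ∃ B : ℂ → ℂ,
      AnalyticOnNhd ℂ B (Metric.closedBall 0 R) ∧ B 0 = 1 ∧
      ∀ w, ‖w‖ ≤ R → (∀ n, 1 - w * s n ≠ 0) →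
        B w = (∏ n ∈ I, (1 - w * s n)) * perturbationDet s d w := by
  classical
  -- For all other indices `‖w s n‖ < 1 / 2` on the disc, so only these contribute poles.
  have hfin : {n | 1 / 2 ≤ R * ‖s n‖}.Finite := by
    have h1 : Tendsto (fun n => R * ‖s n‖) atTop (𝓝 0) := by simpa using hs0.norm.const_mul R
    have h2 := h1.eventually_lt_const (show (0 : ℝ) < 1 / 2 by norm_num)
    rw [← Nat.cofinite_eq_atTop, eventually_cofinite] at h2
    simpa using h2
  set I := hfin.toFinset with hI
  have hmemI (n : ℕ) : n ∈ I ↔ 1 / 2 ≤ R * ‖s n‖ := by simp [hI]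
  have hbd (n : ℕ) (hn : n ∉ I) (w : ℂ) (hw : w ∈ Metric.ball (0 : ℂ) (3 / 2 * R)) :
      1 / 4 ≤ ‖1 - w * s n‖ := by
    rw [hmemI, not_le] at hn
    rw [mem_ball_zero_iff] at hw
    have h1 : ‖w * s n‖ ≤ 3 / 4 := by
      rw [norm_mul]
      calc ‖w‖ * ‖s n‖ ≤ 3 / 2 * R * ‖s n‖ := by gcongr
        _ ≤ 3 / 4 := by linarith
    have h2 := norm_sub_norm_le (1 : ℂ) (w * s n)
    rw [norm_one] at h2
    linarith
  have htail (n : ℕ) (w : ℂ) (hw : w ∈ Metric.ball (0 : ℂ) (3 / 2 * R)) :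
      ‖if n ∈ I then 0 else d n / (1 - w * s n)‖ ≤ 4 * ‖d n‖ := by
    split_ifs with h
    · simp
    · rw [norm_div, div_le_iff₀ (lt_of_lt_of_le (by norm_num) (hbd n h w hw))]
      nlinarith [hbd n h w hw, norm_nonneg (d n)]
  set G : ℂ → ℂ := fun w => ∑' n, if n ∈ I then 0 else d n / (1 - w * s n) with hG
  have hGd : DifferentiableOn ℂ G (Metric.ball 0 (3 / 2 * R)) := by
    refine Complex.differentiableOn_tsum_of_summable_norm (hd.mul_left 4) (fun n => ?_)
      Metric.isOpen_ball fun n w hw => htail n w hw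
    split_ifs with h
    · exact differentiableOn_const _
    · refine (differentiableOn_const _).div (by fun_prop) fun w hw h0 => ?_
      have := hbd n h w hw
      rw [h0, norm_zero] at this
      linarith
  have hsub : Metric.closedBall (0 : ℂ) R ⊆ Metric.ball 0 (3 / 2 * R) :=
    Metric.closedBall_subset_ball (by linarith)
  refine ⟨I, fun n hn => (hmemI n).1 hn, fun w => (∏ n ∈ I, (1 - w * s n)) * (1 - w * G w) -
    w * ∑ n ∈ I, d n * ∏ k ∈ I.erase n, (1 - w * s k), ?_, ?_, ?_⟩
  · have hprod (J : Finset ℕ) : Differentiable ℂ fun w => ∏ n ∈ J, (1 - w * s n) :=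
      Differentiable.fun_finsetProd fun n _ => by fun_prop
    have hsum : Differentiable ℂ fun w => ∑ n ∈ I, d n * ∏ k ∈ I.erase n, (1 - w * s k) :=
      Differentiable.fun_sum fun n _ => (hprod _).const_mul _
    refine (DifferentiableOn.analyticOnNhd ?_ Metric.isOpen_ball).mono hsub
    exact ((hprod I).differentiableOn.mul ((differentiableOn_const _).sub
      (differentiableOn_id.mul hGd))).sub (differentiableOn_id.mul hsum.differentiableOn)
  · simp
  · intro w hw hne
    have h1 : cauchySeries s d w = (∑ n ∈ I, d n / (1 - w * s n)) + G w := by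
      have hsplit : (fun n => d n / (1 - w * s n)) = fun n =>
          (if n ∈ I then d n / (1 - w * s n) else 0) +
            (if n ∈ I then 0 else d n / (1 - w * s n)) := by
        funext n; split_ifs <;> simp
      have hw' := hsub (mem_closedBall_zero_iff.2 hw)
      rw [cauchySeries, hsplit, Summable.tsum_add]
      · congr 1
        rw [tsum_eq_sum (s := I) fun n hn => by simp [hn]]
        exact Finset.sum_congr rfl fun n hn => by simp [hn]
      · exact summable_of_ne_finset_zero (s := I) fun n hn => by simp [hn]
      · exact Summable.of_norm_bounded (hd.mul_left 4) fun n => htail n w hw'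
    have h2 : ∑ n ∈ I, d n * ∏ k ∈ I.erase n, (1 - w * s k) =
        (∏ n ∈ I, (1 - w * s n)) * ∑ n ∈ I, d n / (1 - w * s n) := by
      rw [Finset.mul_sum]
      refine Finset.sum_congr rfl fun n hn => ?_
      rw [← Finset.mul_prod_erase _ _ hn]
      field_simp [hne n]
    simp only [perturbationDet, h1, h2]
    ring

/-- The finite product that cancels the poles of `Δ` in the disc of radius `R` is at most
`exp (C R ^ p)`. -/
theorem prod_norm_one_sub_le {s : ℕ → ℂ} {p : ℝ} (hp : 0 < p)
    (hsp : Summable fun n => ‖s n‖ ^ p) {R : ℝ} (hR : 0 < R) {I : Finset ℕ}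
    (hI : ∀ n ∈ I, 1 / 2 ≤ R * ‖s n‖) {w : ℂ} (hw : ‖w‖ ≤ R) :
    ‖∏ n ∈ I, (1 - w * s n)‖ ≤ Real.exp ((3 * R) ^ p * (∑' n, ‖s n‖ ^ p) / p) := by
  calc ‖∏ n ∈ I, (1 - w * s n)‖ = ∏ n ∈ I, ‖1 - w * s n‖ := norm_prod _ _
    _ ≤ ∏ n ∈ I, Real.exp ((3 * R) ^ p * ‖s n‖ ^ p / p) := by
        refine Finset.prod_le_prod (fun _ _ => norm_nonneg _) fun n hn => ?_
        have h1 : ‖1 - w * s n‖ ≤ 3 * (R * ‖s n‖) := by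
          have := norm_sub_le (1 : ℂ) (w * s n)
          rw [norm_one, norm_mul] at this
          have h3 : ‖w‖ * ‖s n‖ ≤ R * ‖s n‖ := by gcongr
          linarith [hI n hn]
        have h2 : 0 < 3 * (R * ‖s n‖) := by linarith [hI n hn]
        -- The inequality `log x ≤ x ^ p / p` brings in the summability of `‖s n‖ ^ p`.
        refine h1.trans ((Real.log_le_iff_le_exp h2).1 ?_)
        refine (Real.log_le_rpow_div h2.le hp).trans (le_of_eq ?_)
        rw [← mul_assoc, Real.mul_rpow (by positivity) (norm_nonneg _)]
    _ = Real.exp (∑ n ∈ I, (3 * R) ^ p * ‖s n‖ ^ p / p) := (Real.exp_sum _ _).symm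
    _ ≤ _ := by
        rw [Real.exp_le_exp, ← Finset.sum_div, ← Finset.mul_sum]
        gcongr
        exact hsp.sum_le_tsum _ fun _ _ => by positivity

open Real in
/-- The key estimate towards finite order. The function `Δ` may be small near the rays, but the
circle means of `log⁻ ‖Δ‖` are controlled: `Δ` becomes analytic after multiplication by a finite
product whose logarithm is `O(R ^ p)`, and Jensen's formula bounds the mean of `log ‖Δ‖` from
below. -/
theorem exists_circleAverage_posLog_norm_le {m : ℕ} {α : Fin m → ℝ} {s c₀ c₁ c₂ d : ℕ → ℂ}
    (hs0 : Tendsto s atTop (𝓝 0)) (hs : ∀ n, s n ≠ 0 → ∃ l, s n ∈ closedRay (α l))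
    {p : ℝ} (hp : 0 < p) (hsp : Summable fun n => ‖s n‖ ^ p)
    (hc₀ : Summable fun n => ‖c₀ n‖) (hc₁ : Summable fun n => ‖c₁ n‖)
    (hc₂ : Summable fun n => ‖c₂ n‖) (hd : Summable fun n => ‖d n‖)
    {F : ℂ → ℂ} (hF : Differentiable ℂ F)
    (hrel : ∀ w, (∀ n, 1 - w * s n ≠ 0) → F w * perturbationDet s d w =
      cauchySeries s c₀ w * perturbationDet s d w +
        w * (cauchySeries s c₁ w * cauchySeries s c₂ w)) :
    ∃ C, 0 ≤ C ∧ ∀ R, 0 < R →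
      circleAverage (fun z => log⁺ ‖F z‖) 0 R ≤ C * (1 + R) ^ (p + 1) := by
  set S := ∑' n, ‖s n‖ ^ p
  set k₀ := ∑' n, ‖c₀ n‖
  set k₁ := ∑' n, ‖c₁ n‖
  set k₂ := ∑' n, ‖c₂ n‖
  set k := ∑' n, ‖d n‖
  have hS : 0 ≤ S := tsum_nonneg fun _ => by positivity
  have hk₀ : 0 ≤ k₀ := tsum_nonneg fun _ => norm_nonneg _
  have hk₁ : 0 ≤ k₁ := tsum_nonneg fun _ => norm_nonneg _
  have hk₂ : 0 ≤ k₂ := tsum_nonneg fun _ => norm_nonneg _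
  have hk : 0 ≤ k := tsum_nonneg fun _ => norm_nonneg _
  set K := (1 + k₀) * (1 + k) + k₁ * k₂ with hK
  have hK1 : 1 ≤ K := by nlinarith [mul_nonneg hk₁ hk₂, mul_nonneg hk₀ hk]
  set J := ∫ θ in (0 : ℝ)..2 * π, log (sinProd α θ) with hJ
  set D := |(2 * π)⁻¹ * (2 * J)| with hD
  refine ⟨3 ^ p * S / p + (log K + 1) + D, ?_, fun R hR => ?_⟩
  · have := log_nonneg hK1
    positivity
  obtain ⟨I, hI, B, hB, hB0, hBrel⟩ := exists_analytic_prod_mul_perturbationDet hs0 hd hR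
  set N := (3 * R) ^ p * S / p with hN
  set E := N + log (K * (1 + R)) with hE
  have hsph : Metric.sphere (0 : ℂ) |R| ⊆ Metric.closedBall 0 R := by
    rw [abs_of_pos hR]; exact Metric.sphere_subset_closedBall
  -- Outside the zeros of `B` and of `δ = sinProd α`, both `‖F‖ ‖B‖` and `‖B‖` are at
  -- most `exp E / δ ^ 2`.
  have hpt (θ : ℝ) (hθ : sinProd α θ ≠ 0) (hBθ : B (circleMap 0 R θ) ≠ 0) :
      log⁺ ‖F (circleMap 0 R θ)‖ ≤ E - 2 * log (sinProd α θ) - log ‖B (circleMap 0 R θ)‖ := by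
    set δ := sinProd α θ with hδ
    have hδ0 : 0 < δ := lt_of_le_of_ne (sinProd_nonneg α θ) (Ne.symm hθ)
    have hδ1 : δ ≤ 1 := sinProd_le_one α θ
    have hwR : circleMap 0 R θ = R * Complex.exp (θ * Complex.I) := circleMap_zero R θ
    set w := circleMap 0 R θ
    have hw : ‖w‖ = R := by rw [hwR]; simp [abs_of_pos hR]
    have hne (n : ℕ) : 1 - w * s n ≠ 0 := fun h0 => by
      have := sinProd_le_norm_one_sub hs R θ n
      rw [← hwR, h0, norm_zero] at this
      exact absurd this (not_le.2 hδ0)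
    have e₀ : ‖cauchySeries s c₀ w‖ ≤ k₀ / δ := by rw [hwR]; exact norm_cauchySeries_le hs hc₀ R hδ0
    have e₁ : ‖cauchySeries s c₁ w‖ ≤ k₁ / δ := by rw [hwR]; exact norm_cauchySeries_le hs hc₁ R hδ0
    have e₂ : ‖cauchySeries s c₂ w‖ ≤ k₂ / δ := by rw [hwR]; exact norm_cauchySeries_le hs hc₂ R hδ0
    have eΔ : ‖perturbationDet s d w‖ ≤ (1 + R) * (1 + k) / δ := by
      have e : ‖cauchySeries s d w‖ ≤ k / δ := by rw [hwR]; exact norm_cauchySeries_le hs hd R hδ0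
      calc ‖perturbationDet s d w‖ ≤ ‖(1 : ℂ)‖ + ‖w * cauchySeries s d w‖ := norm_sub_le _ _
        _ ≤ 1 / δ + R * (k / δ) := by
            rw [norm_one, norm_mul, hw]
            gcongr
            exact (one_le_div hδ0).2 hδ1
        _ ≤ (1 + R) * (1 + k) / δ := by
            rw [mul_div_assoc', ← add_div]; gcongr; nlinarith
    set Q := ∏ n ∈ I, (1 - w * s n)
    have eQ : ‖Q‖ ≤ exp N := prod_norm_one_sub_le hp hsp hR hI hw.le
    have hBw := hBrel w hw.le hne
    have hexpE : exp (E - 2 * log δ) = exp N * (K * (1 + R)) / δ ^ 2 := by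
      rw [exp_sub, hE, exp_add, exp_log (by positivity), two_mul, exp_add, exp_log hδ0, sq]
    have hδ2 : δ ^ 2 ≤ δ := by nlinarith
    have hB1 : ‖B w‖ ≤ exp (E - 2 * log δ) := by
      rw [hexpE, hBw, norm_mul, mul_div_assoc]
      refine mul_le_mul eQ (eΔ.trans ?_) (norm_nonneg _) (exp_pos _).le
      refine div_le_div₀ (by positivity) ?_ (by positivity) hδ2
      rw [mul_comm]
      gcongr
      nlinarith [mul_nonneg hk₁ hk₂, mul_nonneg hk₀ hk]
    have hB2 : ‖F w‖ * ‖B w‖ ≤ exp (E - 2 * log δ) := by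
      rw [← norm_mul, hBw, mul_left_comm, hrel w hne, norm_mul, hexpE, mul_div_assoc]
      refine mul_le_mul eQ ?_ (norm_nonneg _) (exp_pos _).le
      calc _ ≤ ‖cauchySeries s c₀ w‖ * ‖perturbationDet s d w‖ +
            ‖w‖ * (‖cauchySeries s c₁ w‖ * ‖cauchySeries s c₂ w‖) := by
            refine (norm_add_le _ _).trans (le_of_eq ?_)
            simp only [norm_mul]
        _ ≤ k₀ / δ * ((1 + R) * (1 + k) / δ) + R * (k₁ / δ * (k₂ / δ)) := by
            rw [hw]; gcongr
        _ = (k₀ * ((1 + R) * (1 + k)) + R * (k₁ * k₂)) / δ ^ 2 := by field_simp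
        _ ≤ K * (1 + R) / δ ^ 2 := by
            gcongr
            have h1 := mul_nonneg hk₁ hk₂
            have h2 : 0 ≤ (1 + R) * (1 + k) := by positivity
            rw [hK]; nlinarith
    have hBpos : 0 < ‖B w‖ := norm_pos_iff.2 hBθ
    have hlB : log ‖B w‖ ≤ E - 2 * log δ := (log_le_iff_le_exp hBpos).2 hB1
    rw [posLog_apply]
    refine max_le (by linarith) ?_
    by_cases hF0 : F w = 0
    · rw [hF0, norm_zero, log_zero]; linarith
    have hFpos : 0 < ‖F w‖ := norm_pos_iff.2 hF0
    have := (log_le_iff_le_exp (mul_pos hFpos hBpos)).2 hB2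
    rw [log_mul hFpos.ne' hBpos.ne'] at this
    linarith
  have hBae : ∀ᵐ θ ∂(MeasureTheory.volume.restrict (Set.uIoc 0 (2 * π))),
      B (circleMap 0 R θ) ≠ 0 := by
    have h1 : ∀ᶠ z in codiscreteWithin (Metric.sphere (0 : ℂ) |R|), B z ≠ 0 := by
      refine codiscreteWithin_mono hsph ?_
      rcases hB.eqOn_zero_or_eventually_ne_zero_of_preconnected
        (convex_closedBall (0 : ℂ) R).isPreconnected with h | h
      · have := h (Metric.mem_closedBall_self hR.le)
        rw [hB0] at this
        exact absurd this one_ne_zero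
      · exact h
    apply ae_restrict_le_codiscreteWithin measurableSet_uIoc
    exact codiscreteWithin_mono (by tauto) (circleMap_preimage_codiscrete hR.ne' h1)
  have hJensen : 0 ≤ (2 * π)⁻¹ * ∫ θ in (0 : ℝ)..2 * π, log ‖B (circleMap 0 R θ)‖ := by
    have := hB.log_norm_le_circleAverage hR (by rw [hB0]; exact one_ne_zero)
    rwa [hB0, norm_one, log_one] at this
  have hiB : IntervalIntegrable (fun θ => log ‖B (circleMap 0 R θ)‖) MeasureTheory.volume 0
      (2 * π) := MeromorphicOn.circleIntegrable_log_norm fun z hz => (hB z (hsph hz)).meromorphicAt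
  have hiS := (intervalIntegrable_log_sinProd α 0 (2 * π)).const_mul 2
  have hint : ∫ θ in (0 : ℝ)..2 * π, log⁺ ‖F (circleMap 0 R θ)‖ ≤
      ∫ θ in (0 : ℝ)..2 * π, (E - 2 * log (sinProd α θ) - log ‖B (circleMap 0 R θ)‖) := by
    refine intervalIntegral.integral_mono_ae_restrict two_pi_pos.le ?_
      ((intervalIntegrable_const.sub hiS).sub hiB) ?_
    · refine Continuous.intervalIntegrable ?_ _ _
      exact continuous_posLog.comp (hF.continuous.comp (continuous_circleMap 0 R)).norm
    · rw [Set.uIoc_of_le two_pi_pos.le] at hBae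
      rw [MeasureTheory.Measure.restrict_congr_set MeasureTheory.Ioc_ae_eq_Icc.symm]
      filter_upwards [hBae, MeasureTheory.ae_restrict_of_ae
        ((countable_setOf_sinProd_eq_zero α).ae_notMem MeasureTheory.volume)] with θ h1 h2
      exact hpt θ h2 h1
  rw [intervalIntegral.integral_sub (intervalIntegrable_const.sub hiS) hiB,
    intervalIntegral.integral_sub intervalIntegrable_const hiS,
    intervalIntegral.integral_const_mul, intervalIntegral.integral_const, ← hJ, smul_eq_mul,
    sub_zero] at hint
  have hcA : circleAverage (fun z => log⁺ ‖F z‖) 0 R ≤ E + D := by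
    rw [circleAverage, smul_eq_mul]
    have h1 := mul_le_mul_of_nonneg_left hint (show 0 ≤ (2 * π)⁻¹ by positivity)
    rw [mul_sub, mul_sub, ← mul_assoc, inv_mul_cancel₀ (by positivity), one_mul] at h1
    have h2 := neg_abs_le ((2 * π)⁻¹ * (2 * J))
    linarith
  refine hcA.trans ?_
  have hR1 : 1 ≤ (1 + R) ^ (p + 1) := one_le_rpow (by linarith) (by linarith)
  have hN1 : N ≤ 3 ^ p * S / p * (1 + R) ^ (p + 1) := by
    have : R ^ p ≤ (1 + R) ^ (p + 1) :=
      (rpow_le_rpow hR.le (by linarith) hp.le).trans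
        (rpow_le_rpow_of_exponent_le (by linarith) (by linarith))
    rw [hN, mul_rpow (by norm_num) hR.le]
    calc 3 ^ p * R ^ p * S / p = 3 ^ p * S / p * R ^ p := by ring
      _ ≤ _ := by gcongr
  have hlog : log (K * (1 + R)) ≤ (log K + 1) * (1 + R) ^ (p + 1) := by
    rw [log_mul (by positivity) (by positivity), add_mul, one_mul]
    have h1 : log (1 + R) ≤ (1 + R) ^ (p + 1) := by
      have h2 : log (1 + R) ≤ 1 + R := (log_le_sub_one_of_pos (by linarith)).trans (by linarith)
      refine h2.trans ?_
      conv_lhs => rw [← rpow_one (1 + R)]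
      exact rpow_le_rpow_of_exponent_le (by linarith) (by linarith)
    have h3 : log K ≤ log K * (1 + R) ^ (p + 1) := le_mul_of_one_le_right (log_nonneg hK1) hR1
    linarith
  have hD1 : D ≤ D * (1 + R) ^ (p + 1) := le_mul_of_one_le_right (abs_nonneg _) hR1
  rw [add_mul, add_mul]
  linarith

/-! ### Asymptotics of the perturbation determinant -/

/-- If `(M_k)` fails, then near `0`, away from the rays, the perturbation determinant
`1 + ∑ d n / (s n - z)` behaves like `c z ^ j` with `c ≠ 0`. Here `j + 1 ≤ k` is the least index
whose moment equation fails. -/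
theorem exists_tendsto_perturbationDet_div_pow {s d : ℕ → ℂ} (hs0 : Tendsto s atTop (𝓝 0))
    (hd0 : ∀ n, s n = 0 → d n = 0) {k : ℕ} (hk : 1 ≤ k)
    (hsum : Summable fun n => ‖s n‖ ^ (-(k : ℤ)) * ‖d n‖)
    (hM : ¬ HasSum (fun n => s n ^ (-(k : ℤ)) * d n) (if k = 1 then -1 else 0)) :
    ∃ j : ℕ, ∃ c : ℂ, c ≠ 0 ∧ ∀ (Z : Set ℂ) (δ : ℝ), 0 < δ →
      (∀ z ∈ Z, z ≠ 0 ∧ ∀ n, s n ≠ 0 → δ * ‖z‖ ≤ ‖s n - z‖) →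
      Tendsto (fun z => (1 + ∑' n, d n / (s n - z)) / z ^ j) (𝓝[Z] 0) (𝓝 c) := by
  obtain ⟨S, hS⟩ := hs0.norm.bddAbove_range
  have hS' (n : ℕ) : ‖s n‖ ≤ max S 1 := (hS ⟨n, rfl⟩).trans (le_max_left _ _)
  have hsumk (l : ℕ) (hl : l ≤ k) : Summable fun n => ‖d n / s n ^ l‖ := by
    refine Summable.of_nonneg_of_le (fun _ => norm_nonneg _) (fun n => ?_)
      (hsum.mul_left (max S 1 ^ k))
    rcases eq_or_ne (s n) 0 with h0 | h0
    · simp [hd0 n h0]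
    · have hpos : 0 < ‖s n‖ := norm_pos_iff.2 h0
      have h1 : ‖d n / s n ^ l‖ = ‖s n‖ ^ (k - l) * (‖s n‖ ^ (-(k : ℤ)) * ‖d n‖) := by
        rw [norm_div, norm_pow, zpow_neg, zpow_natCast, pow_sub₀ _ hpos.ne' hl]
        field_simp
      rw [h1]
      gcongr
      exact (pow_le_pow_left₀ hpos.le (hS' n) _).trans
        (pow_le_pow_right₀ (le_max_right _ _) (Nat.sub_le _ _))
  -- The moment equation of index `l ≥ 1` says that `e l = 0`.
  set e : ℕ → ℂ := fun l => (if l = 1 then 1 else 0) + ∑' n, d n / s n ^ l with he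
  have hek : e k ≠ 0 := fun h0 => hM <| by
    have h1 : ∑' n, d n / s n ^ k = if k = 1 then -1 else 0 := by
      simp only [he] at h0
      split_ifs at h0 ⊢ with hk1
      · linear_combination h0
      · linear_combination h0
    rw [← h1]
    convert! (hsumk k le_rfl).of_norm.hasSum using 1
    funext n
    rw [zpow_neg, zpow_natCast, div_eq_mul_inv, mul_comm]
  classical
  have hex : ∃ j, e (j + 1) ≠ 0 := ⟨k - 1, by rwa [Nat.sub_add_cancel hk]⟩
  have hjk : Nat.find hex + 1 ≤ k := by
    have := Nat.find_min' hex (m := k - 1) (by rwa [Nat.sub_add_cancel hk])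
    omega
  have hmin (i : ℕ) (hi : i < Nat.find hex) : e (i + 1) = 0 := by
    simpa using Nat.find_min hex hi
  refine ⟨Nat.find hex, e (Nat.find hex + 1), Nat.find_spec hex, fun Z δ hδ hZ => ?_⟩
  set j := Nat.find hex
  set T : ℕ → ℂ → ℂ := fun l z => ∑' n, d n / s n ^ l / (s n - z) with hT
  have hterm (l : ℕ) (z : ℂ) (hz : z ∈ Z) (n : ℕ) :
      ‖z * (d n / s n ^ l / (s n - z))‖ ≤ ‖d n / s n ^ l‖ / δ := by
    rcases eq_or_ne (s n) 0 with h0 | h0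
    · simp [hd0 n h0]
    · have hz0 : 0 < ‖z‖ := norm_pos_iff.2 (hZ z hz).1
      have h1 := (hZ z hz).2 n h0
      have h2 : 0 < ‖s n - z‖ := lt_of_lt_of_le (by positivity) h1
      rw [norm_mul, norm_div _ (s n - z), mul_div_assoc', div_le_div_iff₀ h2 hδ]
      nlinarith [norm_nonneg (d n / s n ^ l)]
  have hsumT (l : ℕ) (hl : l ≤ k) (z : ℂ) (hz : z ∈ Z) :
      Summable fun n => z * (d n / s n ^ l / (s n - z)) :=
    Summable.of_norm_bounded ((hsumk l hl).div_const δ) (hterm l z hz)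
  -- From `1 / (s n - z) = 1 / s n + z / (s n (s n - z))`.
  have hstep (l : ℕ) (hl : l + 1 ≤ k) (z : ℂ) (hz : z ∈ Z) :
      T l z = (∑' n, d n / s n ^ (l + 1)) + z * T (l + 1) z := by
    simp only [hT]
    rw [← tsum_mul_left, ← Summable.tsum_add (hsumk _ hl).of_norm (hsumT _ hl z hz)]
    refine tsum_congr fun n => ?_
    rcases eq_or_ne (s n) 0 with h0 | h0
    · simp [hd0 n h0]
    · have h1 := (hZ z hz).2 n h0
      have hz0 : 0 < ‖z‖ := norm_pos_iff.2 (hZ z hz).1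
      have h2 : s n - z ≠ 0 := norm_pos_iff.1 (lt_of_lt_of_le (by positivity) h1)
      field_simp
      ring
  have hind (z : ℂ) (hz : z ∈ Z) (i : ℕ) (hi : i ≤ j) :
      1 + T 0 z = (if i = 0 then 1 else 0) + z ^ i * T i z := by
    induction i with
    | zero => simp
    | succ i ih =>
      have h1 := hmin i (by omega)
      rw [ih (by omega), hstep i (by omega) z hz]
      simp only [he] at h1
      rcases Nat.eq_zero_or_pos i with rfl | hi0
      · simp only [zero_add, ↓reduceIte, pow_zero, one_mul, pow_one, one_ne_zero] at h1 ⊢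
        linear_combination h1
      · rw [if_neg (by omega)] at h1
        rw [if_neg (by omega), if_neg (by omega)]
        linear_combination z ^ i * h1
  have hfin (z : ℂ) (hz : z ∈ Z) :
      (1 + ∑' n, d n / (s n - z)) / z ^ j = e (j + 1) + z * T (j + 1) z := by
    have h1 : (∑' n, d n / (s n - z)) = T 0 z := by simp [hT]
    have hz0 : z ^ j ≠ 0 := pow_ne_zero _ (hZ z hz).1
    rw [div_eq_iff hz0, h1, hind z hz j le_rfl, hstep j hjk z hz]
    simp only [he]
    by_cases hj0 : j = 0
    · simp [hj0]; ring
    · simp [hj0]; ring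
  have hlim : Tendsto (fun z => ∑' n, z * (d n / s n ^ (j + 1) / (s n - z))) (𝓝[Z] 0) (𝓝 0) := by
    have : Tendsto (fun z => ∑' n, z * (d n / s n ^ (j + 1) / (s n - z))) (𝓝[Z] 0)
        (𝓝 (∑' _ : ℕ, (0 : ℂ))) := by
      refine tendsto_tsum_of_dominated_convergence ((hsumk _ hjk).div_const δ) (fun n => ?_) ?_
      · rcases eq_or_ne (s n) 0 with h0 | h0
        · simp [hd0 n h0, tendsto_const_nhds]
        · have hc : ContinuousAt (fun z => z * (d n / s n ^ (j + 1) / (s n - z))) 0 := by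
            refine continuousAt_id.mul (continuousAt_const.div (by fun_prop) ?_)
            simpa using h0
          have := hc.tendsto.mono_left (nhdsWithin_le_nhds (s := Z))
          simpa using this
      · filter_upwards [self_mem_nhdsWithin] with z hz n using hterm _ z hz n
    simpa using this
  have h2 := hlim.const_add (e (j + 1))
  rw [add_zero] at h2
  refine h2.congr' ?_
  filter_upwards [self_mem_nhdsWithin] with z hz
  rw [hfin z hz, hT, tsum_mul_left]

section Ray

variable {m : ℕ} {α : Fin m → ℝ} {s c₀ c₁ c₂ d : ℕ → ℂ}

theorem perturbationDet_eq {s d : ℕ → ℂ} {w : ℂ} (hw : w ≠ 0) (hne : ∀ n, 1 - w * s n ≠ 0) :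
    perturbationDet s d w = 1 + ∑' n, d n / (s n - w⁻¹) := by
  rw [perturbationDet, cauchySeries, sub_eq_add_neg, ← neg_mul, ← tsum_mul_left]
  congr 1
  refine tsum_congr fun n => ?_
  have h1 := hne n
  have h2 : s n - w⁻¹ ≠ 0 := fun h => h1 (by
    rw [sub_eq_zero.1 h, mul_inv_cancel₀ hw, sub_self])
  have h3 : s n * w - 1 ≠ 0 := fun h => h1 (by linear_combination -h)
  rw [mul_div_assoc', div_eq_div_iff h1 h2]
  field_simp
  ring

/-- On almost every ray the matrix elements of the resolvent grow at most polynomially. -/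
theorem exists_norm_le_pow_on_ray (hs : ∀ n, s n ≠ 0 → ∃ l, s n ∈ closedRay (α l))
    (hc₀ : Summable fun n => ‖c₀ n‖) (hc₁ : Summable fun n => ‖c₁ n‖)
    (hc₂ : Summable fun n => ‖c₂ n‖) {F : ℂ → ℂ}
    (hrel : ∀ w, (∀ n, 1 - w * s n ≠ 0) → F w * perturbationDet s d w =
      cauchySeries s c₀ w * perturbationDet s d w +
        w * (cauchySeries s c₁ w * cauchySeries s c₂ w))
    {j : ℕ} {c : ℂ} (hc : c ≠ 0) (hdet : ∀ (Z : Set ℂ) (δ : ℝ), 0 < δ →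
      (∀ z ∈ Z, z ≠ 0 ∧ ∀ n, s n ≠ 0 → δ * ‖z‖ ≤ ‖s n - z‖) →
      Tendsto (fun z => (1 + ∑' n, d n / (s n - z)) / z ^ j) (𝓝[Z] 0) (𝓝 c))
    {θ : ℝ} (hθ : 0 < sinProd α θ) :
    ∃ M R₀ : ℝ, ∀ ρ : ℝ, R₀ ≤ ρ → ‖F (ρ * Complex.exp (θ * Complex.I))‖ ≤ M * ρ ^ (j + 1) := by
  set δ := sinProd α θ with hδ
  set E := Complex.exp (θ * Complex.I) with hE
  have hEn : ‖E‖ = 1 := Complex.norm_exp_ofReal_mul_I θ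
  have hE0 : E ≠ 0 := Complex.exp_ne_zero _
  have hne (ρ : ℝ) (n : ℕ) : 1 - ρ * E * s n ≠ 0 := fun h0 => by
    have := sinProd_le_norm_one_sub hs ρ θ n
    rw [← hE, h0, norm_zero] at this
    exact absurd this (not_le.2 hθ)
  set Z : Set ℂ := {z | ∃ ρ : ℝ, 0 < ρ ∧ z = (ρ * E)⁻¹} with hZ
  have hlim := hdet Z δ hθ <| by
    rintro _ ⟨ρ, hρ, rfl⟩
    have hw0 : (ρ : ℂ) * E ≠ 0 := mul_ne_zero (by exact_mod_cast hρ.ne') hE0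
    refine ⟨inv_ne_zero hw0, fun n _ => ?_⟩
    have h1 : s n - (ρ * E)⁻¹ = -((1 - ρ * E * s n) * (ρ * E)⁻¹) := by
      linear_combination (-s n) * mul_inv_cancel₀ hw0
    rw [h1, norm_neg, norm_mul]
    gcongr
    exact sinProd_le_norm_one_sub hs ρ θ n
  have hray : Tendsto (fun ρ : ℝ => ((ρ : ℂ) * E)⁻¹) atTop (𝓝[Z] 0) := by
    refine tendsto_nhdsWithin_iff.2 ⟨?_, ?_⟩
    · rw [tendsto_zero_iff_norm_tendsto_zero]
      refine tendsto_inv_atTop_zero.congr' ?_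
      filter_upwards [eventually_gt_atTop 0] with ρ hρ
      simp [hEn, abs_of_pos hρ]
    · filter_upwards [eventually_gt_atTop 0] with ρ hρ using ⟨ρ, hρ, rfl⟩
  have hev : ∀ᶠ ρ : ℝ in atTop, ‖c‖ / 2 <
      ‖(1 + ∑' n, d n / (s n - ((ρ : ℂ) * E)⁻¹)) / (((ρ : ℂ) * E)⁻¹) ^ j‖ :=
    (hlim.comp hray).norm.eventually_const_lt (half_lt_self (norm_pos_iff.2 hc))
  obtain ⟨R₀, hR₀⟩ := eventually_atTop.1 hev
  set k₀ := ∑' n, ‖c₀ n‖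
  set k₁ := ∑' n, ‖c₁ n‖
  set k₂ := ∑' n, ‖c₂ n‖
  have hk₀ : 0 ≤ k₀ := tsum_nonneg fun _ => norm_nonneg _
  have hk₁ : 0 ≤ k₁ := tsum_nonneg fun _ => norm_nonneg _
  have hk₂ : 0 ≤ k₂ := tsum_nonneg fun _ => norm_nonneg _
  have hcpos : 0 < ‖c‖ / 2 := half_pos (norm_pos_iff.2 hc)
  refine ⟨k₀ / δ + k₁ / δ * (k₂ / δ) / (‖c‖ / 2), max R₀ 1, fun ρ hρ => ?_⟩
  have hρ1 : 1 ≤ ρ := (le_max_right _ _).trans hρ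
  have hρ0 : 0 < ρ := by linarith
  have hw0 : (ρ : ℂ) * E ≠ 0 := mul_ne_zero (by exact_mod_cast hρ0.ne') hE0
  have hwn : ‖(ρ : ℂ) * E‖ = ρ := by simp [hEn, abs_of_pos hρ0]
  have e₀ := norm_cauchySeries_le hs hc₀ ρ hθ
  have e₁ := norm_cauchySeries_le hs hc₁ ρ hθ
  have e₂ := norm_cauchySeries_le hs hc₂ ρ hθ
  rw [← hE] at e₀ e₁ e₂
  have h1 := hR₀ ρ ((le_max_left _ _).trans hρ)
  rw [← perturbationDet_eq hw0 (hne ρ), norm_div, norm_pow, norm_inv, hwn, inv_pow, div_inv_eq_mul]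
    at h1
  have h2 := hrel _ (hne ρ)
  set w := (ρ : ℂ) * E
  set Δ := perturbationDet s d w
  have hΔ : Δ ≠ 0 := fun h => by
    rw [h, norm_zero, zero_mul] at h1; linarith
  have hΔpos : 0 < ‖Δ‖ := norm_pos_iff.2 hΔ
  have h3 : F w = cauchySeries s c₀ w + w * (cauchySeries s c₁ w * cauchySeries s c₂ w) / Δ := by
    field_simp
    linear_combination h2
  have hΔinv : 1 / ‖Δ‖ ≤ ρ ^ j / (‖c‖ / 2) := by
    rw [div_le_div_iff₀ hΔpos hcpos]; linarith
  have hρj : 1 ≤ ρ ^ (j + 1) := one_le_pow₀ hρ1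
  calc ‖F w‖ ≤ ‖cauchySeries s c₀ w‖ +
        ‖w‖ * (‖cauchySeries s c₁ w‖ * ‖cauchySeries s c₂ w‖) * (1 / ‖Δ‖) := by
        rw [h3]
        refine (norm_add_le _ _).trans (le_of_eq ?_)
        rw [norm_div, norm_mul w, norm_mul (cauchySeries s c₁ w)]; ring
    _ ≤ k₀ / δ + ρ * (k₁ / δ * (k₂ / δ)) * (ρ ^ j / (‖c‖ / 2)) := by
        rw [hwn]; gcongr
    _ ≤ k₀ / δ * ρ ^ (j + 1) + ρ * (k₁ / δ * (k₂ / δ)) * (ρ ^ j / (‖c‖ / 2)) := by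
        gcongr
        exact le_mul_of_one_le_right (by positivity) hρj
    _ = _ := by rw [pow_succ]; ring

theorem dense_setOf_sinProd_pos (α : Fin m → ℝ) : Dense {θ | 0 < sinProd α θ} := by
  refine ((countable_setOf_sinProd_eq_zero α).dense_compl ℝ).mono fun θ hθ => ?_
  exact lt_of_le_of_ne (sinProd_nonneg α θ) (Ne.symm hθ)

end Ray

/-! ### Root vectors of compact operators -/

variable {H : Type*} [NormedAddCommGroup H] [InnerProductSpace ℂ H] [CompleteSpace H]

open Module.End in
/-- A compact operator has finite ascent at every non-zero point, hence its root subspaces for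
non-zero eigenvalues are closed. -/
theorem IsCompactOperator.isClosed_maxGenEigenspace {T : H →L[ℂ] H} (hT : IsCompactOperator T)
    {μ : ℂ} (hμ : μ ≠ 0) : IsClosed (maxGenEigenspace (T : H →ₗ[ℂ] H) μ : Set H) := by
  set S : H →ₗ[ℂ] H := (T : H →ₗ[ℂ] H) - μ • (1 : H →ₗ[ℂ] H) with hS
  have hSc (n : ℕ) : IsClosed (LinearMap.ker (S ^ n) : Set H) := by
    have h1 : S ^ n = (((T - μ • (1 : H →L[ℂ] H)) ^ n : H →L[ℂ] H) : H →ₗ[ℂ] H) := by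
      rw [ContinuousLinearMap.toLinearMap_pow]; rfl
    rw [h1]
    exact ContinuousLinearMap.isClosed_ker _
  have hmono : Monotone fun n => LinearMap.ker (S ^ n) := S.iterateKer.monotone
  have hstab : ∃ n, LinearMap.ker (S ^ n) = LinearMap.ker (S ^ (n + 1)) := by
    by_contra! hne
    -- Unit vectors of `ker S ^ (n + 1)` orthogonal to `ker S ^ n` have images under `T` at mutual
    -- distance at least `‖μ‖`, which contradicts compactness.
    have hex (n : ℕ) : ∃ e ∈ LinearMap.ker (S ^ (n + 1)), ‖e‖ = 1 ∧
        ∀ u ∈ LinearMap.ker (S ^ n), inner ℂ e u = 0 := by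
      obtain ⟨v, hv, hv'⟩ := SetLike.exists_of_lt (lt_of_le_of_ne (hmono n.le_succ) (hne n))
      have : CompleteSpace (LinearMap.ker (S ^ n)) := (hSc n).completeSpace_coe
      set V := LinearMap.ker (S ^ n)
      set e₀ : H := v - V.starProjection v with he₀
      have h1 : e₀ ∈ Vᗮ := V.sub_starProjection_mem_orthogonal v
      have h2 : e₀ ≠ 0 := fun h => hv' (by
        rw [sub_eq_zero.1 h]; exact V.starProjection_apply_mem v)
      have h3 : e₀ ∈ LinearMap.ker (S ^ (n + 1)) :=
        Submodule.sub_mem _ hv (hmono n.le_succ (V.starProjection_apply_mem v))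
      refine ⟨((‖e₀‖⁻¹ : ℝ) : ℂ) • e₀, Submodule.smul_mem _ _ h3, ?_, fun u hu => ?_⟩
      · rw [norm_smul, Complex.norm_real, Real.norm_of_nonneg (by positivity),
          inv_mul_cancel₀ (norm_ne_zero_iff.2 h2)]
      · rw [inner_smul_left, (Submodule.mem_orthogonal' V e₀).1 h1 u hu, mul_zero]
    choose e he he1 heo using hex
    have hTS (x : H) : T x = S x + μ • x := by simp [hS]
    have hsep {m n : ℕ} (hmn : m < n) : ‖μ‖ ≤ ‖T (e n) - T (e m)‖ := by
      have hSe (i : ℕ) : S (e i) ∈ LinearMap.ker (S ^ i) := by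
        have := he i
        rw [LinearMap.mem_ker, pow_succ, Module.End.mul_apply] at this
        exact this
      have h1 : T (e n) - T (e m) = μ • e n + (S (e n) - S (e m) - μ • e m) := by
        rw [hTS, hTS]; abel
      have h2 : S (e n) - S (e m) - μ • e m ∈ LinearMap.ker (S ^ n) :=
        Submodule.sub_mem _ (Submodule.sub_mem _ (hSe n) (hmono hmn.le (hSe m)))
          (Submodule.smul_mem _ _ (hmono (Nat.succ_le_of_lt hmn) (he m)))
      have h3 : inner ℂ (e n) (T (e n) - T (e m)) = μ := by
        rw [h1, inner_add_right, heo n _ h2, inner_smul_right, inner_self_eq_norm_sq_to_K, he1]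
        simp
      calc ‖μ‖ = ‖inner ℂ (e n) (T (e n) - T (e m))‖ := by rw [h3]
        _ ≤ ‖e n‖ * ‖T (e n) - T (e m)‖ := norm_inner_le_norm _ _
        _ = _ := by rw [he1, one_mul]
    obtain ⟨C, hC, hC'⟩ := hT.image_closedBall_subset_compact 1
    obtain ⟨y, -, ψ, hψ, hψy⟩ := hC.tendsto_subseq (x := fun n => T (e n))
      (fun n => hC' ⟨e n, by simp [he1], rfl⟩)
    have hcau := hψy.cauchySeq
    rw [Metric.cauchySeq_iff'] at hcau
    obtain ⟨N, hN⟩ := hcau ‖μ‖ (norm_pos_iff.2 hμ)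
    have h1 := hN (N + 1) (Nat.le_succ N)
    rw [dist_eq_norm] at h1
    exact absurd h1 (not_lt.2 (hsep (hψ N.lt_succ_self)))
  obtain ⟨n, hn⟩ := hstab
  have hG : maxGenEigenspace (T : H →ₗ[ℂ] H) μ = LinearMap.ker (S ^ n) := by
    ext x
    rw [mem_maxGenEigenspace]
    constructor
    · rintro ⟨i, hi⟩
      rw [ker_pow_constant hn i]
      exact hmono (Nat.le_add_left i n) hi
    · exact fun hx => ⟨n, hx⟩
  rw [hG]
  exact hSc n

/-- An eigenvector of `T†` for a non-zero eigenvalue is not orthogonal to the corresponding root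
subspace of the compact operator `T`: otherwise the compression of `T` to the orthogonal complement
of the root subspace would still have that eigenvalue. -/
theorem IsCompactOperator.eq_zero_of_adjoint_apply_eq_smul {T : H →L[ℂ] H}
    (hT : IsCompactOperator T) {ν : ℂ} (hν : ν ≠ 0) {x : H}
    (hx : ContinuousLinearMap.adjoint T x = ν • x)
    (hxo : x ∈ (Module.End.maxGenEigenspace (T : H →ₗ[ℂ] H) (starRingEnd ℂ ν))ᗮ) : x = 0 := by
  set μ := starRingEnd ℂ ν with hμ
  have hμ0 : μ ≠ 0 := by simpa [hμ] using hν
  set G := Module.End.maxGenEigenspace (T : H →ₗ[ℂ] H) μ with hG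
  have hGc : IsClosed (G : Set H) := hT.isClosed_maxGenEigenspace hμ0
  -- An eigenvector `v` of the compression `C` for `μ` has `(T - μ) v ∈ G`, so `v ∈ G ∩ Gᗮ = 0`.
  -- Hence `C - μ` is onto, although `x` is orthogonal to its range.
  set C : Gᗮ →L[ℂ] Gᗮ := Gᗮ.orthogonalProjectionOnto ∘L T ∘L Gᗮ.subtypeL with hC
  have hCc : IsCompactOperator C := (hT.comp_clm Gᗮ.subtypeL).clm_comp Gᗮ.orthogonalProjectionOnto
  rcases hCc.hasEigenvalue_or_mem_resolventSet hμ0 with h | h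
  · exfalso
    obtain ⟨v, hv⟩ := h.exists_hasEigenvector
    have hCv : C v = μ • v := hv.apply_eq_smul
    have h1 : Gᗮ.orthogonalProjectionOnto (T v - μ • (v : H)) = 0 := by
      rw [map_sub, map_smul, Submodule.orthogonalProjectionOnto_mem_subspace_eq_self]
      exact sub_eq_zero.2 hCv
    have h2 : T v - μ • (v : H) ∈ G := by
      have := Submodule.orthogonalProjectionOnto_eq_zero_iff.1 h1
      rw [Submodule.orthogonal_orthogonal_eq_closure] at this
      rwa [hGc.submodule_topologicalClosure_eq] at this
    have h3 : (v : H) ∈ G := by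
      obtain ⟨n, hn⟩ := (Module.End.mem_maxGenEigenspace _ _ _).1 h2
      refine (Module.End.mem_maxGenEigenspace _ _ _).2 ⟨n + 1, ?_⟩
      rw [pow_succ, Module.End.mul_apply]
      exact hn
    have h4 := (Submodule.mem_orthogonal G (v : H)).1 v.2 v h3
    exact hv.2 (Subtype.ext (inner_self_eq_zero.1 h4))
  · rw [spectrum.mem_resolventSet_iff, ContinuousLinearMap.isUnit_iff_bijective] at h
    obtain ⟨u, hu⟩ := h.2 ⟨x, hxo⟩
    have h1 : μ • u - C u = ⟨x, hxo⟩ := by simpa [Algebra.algebraMap_eq_smul_one] using hu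
    have h2 : inner ℂ x (((μ • u - C u : Gᗮ) : H)) = 0 := by
      have h3 : inner ℂ x ((C u : Gᗮ) : H) = inner ℂ x (T u) :=
        Submodule.inner_orthogonalProjectionOnto_eq_of_mem_left (⟨x, hxo⟩ : Gᗮ) (T u)
      rw [Submodule.coe_sub, Submodule.coe_smul, inner_sub_right, h3,
        ← ContinuousLinearMap.adjoint_inner_left, hx, inner_smul_left, inner_smul_right, sub_self]
    rw [h1] at h2
    exact inner_self_eq_zero.1 h2

omit [CompleteSpace H] in
theorem mem_rootSpan_orthogonal_iff {T : H →L[ℂ] H} {x : H} :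
    x ∈ (rootSpan T)ᗮ ↔
      ∀ μ : {μ : ℂ // μ ≠ 0}, x ∈ (Module.End.maxGenEigenspace (T : H →ₗ[ℂ] H) (μ : ℂ))ᗮ := by
  rw [rootSpan, Submodule.orthogonal_closure, ← Submodule.iInf_orthogonal, Submodule.mem_iInf]

theorem adjoint_apply_mem_rootSpan_orthogonal (T : H →L[ℂ] H) :
    ∀ x ∈ (rootSpan T)ᗮ, ContinuousLinearMap.adjoint T x ∈ (rootSpan T)ᗮ := by
  intro x hx
  rw [mem_rootSpan_orthogonal_iff] at hx ⊢
  intro μ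
  rw [Submodule.mem_orthogonal]
  intro u hu
  rw [ContinuousLinearMap.adjoint_inner_right]
  exact (Submodule.mem_orthogonal _ _).1 (hx μ) _
    (Module.End.mapsTo_maxGenEigenspace_of_comm (Commute.refl _) _ hu)

/-- **Schauder's theorem** for Hilbert spaces, from
`‖T† x - T† y‖ ^ 2 ≤ ‖T T† x - T T† y‖ ‖x - y‖`. -/
theorem IsCompactOperator.adjoint {T : H →L[ℂ] H} (hT : IsCompactOperator T) :
    IsCompactOperator (ContinuousLinearMap.adjoint T) := by
  set S := ContinuousLinearMap.adjoint T
  set B := Metric.closedBall (0 : H) 1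
  have hTS : TotallyBounded ((T ∘L S) '' B) := by
    obtain ⟨K, hK, hK'⟩ := IsCompactOperator.image_closedBall_subset_compact
      (f := ((T ∘L S : H →L[ℂ] H) : H →ₗ[ℂ] H)) (hT.comp_clm S) 1
    exact hK.totallyBounded.subset hK'
  have hS : TotallyBounded (S '' B) := by
    rw [Metric.totallyBounded_iff]
    intro ε hε
    obtain ⟨t, ht, htf, hcov⟩ := Metric.finite_approx_of_totallyBounded hTS (ε ^ 2 / 2)
      (by positivity)
    obtain ⟨t', ht', htf', rfl⟩ := (Set.exists_subset_image_finite_and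
      (p := fun u => u = t)).1 ⟨t, ht, htf, rfl⟩
    refine ⟨S '' t', htf'.image _, ?_⟩
    rintro _ ⟨x, hx, rfl⟩
    obtain ⟨_, ⟨y, hy, rfl⟩, hxy⟩ := Set.mem_iUnion₂.1 (hcov ⟨x, hx, rfl⟩)
    refine Set.mem_iUnion₂.2 ⟨S y, ⟨y, hy, rfl⟩, ?_⟩
    rw [mem_ball_iff_norm] at hxy ⊢
    have h1 : ‖x - y‖ ≤ 2 := by
      have hx1 := mem_closedBall_zero_iff.1 hx
      have hy1 := mem_closedBall_zero_iff.1 (ht' hy)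
      linarith [norm_sub_le x y]
    have h2 : ‖S x - S y‖ ^ 2 ≤ ‖T (S x) - T (S y)‖ * ‖x - y‖ := by
      have h3 : (inner ℂ (S (x - y)) (S (x - y)) : ℂ) = inner ℂ (T (S (x - y))) (x - y) :=
        ContinuousLinearMap.adjoint_inner_right T _ _
      rw [← map_sub, ← map_sub, ← map_sub]
      calc ‖S (x - y)‖ ^ 2 = ‖(inner ℂ (S (x - y)) (S (x - y)) : ℂ)‖ := by
            rw [inner_self_eq_norm_sq_to_K]; simp
        _ ≤ _ := by rw [h3]; exact norm_inner_le_norm _ _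
    have h3 : ‖S x - S y‖ ^ 2 < ε ^ 2 := by
      change ‖T (S x) - T (S y)‖ < _ at hxy
      nlinarith [norm_nonneg (T (S x) - T (S y)), norm_nonneg (x - y)]
    exact lt_of_pow_lt_pow_left₀ 2 hε.le h3
  exact (isCompactOperator_iff_isCompact_closure_image_closedBall (S : H →ₗ[ℂ] H) one_pos).2
    (hS.closure.isCompact_of_isClosed isClosed_closure)

/-- The restriction of `T†` to the orthogonal complement of the root vectors of `T` is
quasinilpotent. -/
theorem IsCompactOperator.isUnit_one_sub_smul_restrict_adjoint {T : H →L[ℂ] H}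
    (hT : IsCompactOperator T) (w : ℂ) :
    IsUnit (1 - w • (ContinuousLinearMap.adjoint T).restrict
      (adjoint_apply_mem_rootSpan_orthogonal T)) := by
  set Q := (ContinuousLinearMap.adjoint T).restrict (adjoint_apply_mem_rootSpan_orthogonal T)
  rcases eq_or_ne w 0 with rfl | hw
  · have h0 : (0 : ℂ) • Q = 0 := zero_smul ℂ Q
    rw [h0, sub_zero]; exact isUnit_one
  have hQ : IsCompactOperator Q := hT.adjoint.restrict' (adjoint_apply_mem_rootSpan_orthogonal T)
  rcases hQ.hasEigenvalue_or_mem_resolventSet (inv_ne_zero hw) with h | h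
  · exfalso
    obtain ⟨v, hv⟩ := h.exists_hasEigenvector
    have hQv : Q v = w⁻¹ • v := hv.apply_eq_smul
    have hne : starRingEnd ℂ w⁻¹ ≠ 0 := by simpa using hw
    refine hv.2 (Subtype.ext ?_)
    exact hT.eq_zero_of_adjoint_apply_eq_smul (inv_ne_zero hw) (congrArg Subtype.val hQv)
      (mem_rootSpan_orthogonal_iff.1 v.2 ⟨_, hne⟩)
  · rw [spectrum.mem_resolventSet_iff] at h
    have h2 : 1 - w • Q = (Units.mk0 w hw) • (algebraMap ℂ _ w⁻¹ - Q) := by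
      rw [Units.smul_mk0, smul_sub, Algebra.algebraMap_eq_smul_one, smul_inv_smul₀ hw]
    rw [h2]
    exact h.smul _

/-- A closed subspace with finite-dimensional orthogonal complement has finite codimension. -/
theorem nearlyComplete_of_finiteDimensional_orthogonal {T : H →L[ℂ] H}
    (h : FiniteDimensional ℂ (rootSpan T)ᗮ) : NearlyComplete T := by
  have hc : IsClosed (rootSpan T : Set H) := Submodule.isClosed_topologicalClosure _
  have : CompleteSpace (rootSpan T) := hc.completeSpace_coe
  exact Module.Finite.equiv (Submodule.quotientEquivOfIsCompl (rootSpan T) (rootSpan T)ᗮ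
    (Submodule.isCompl_orthogonal _)).symm

/-! ### Diagonalized operators -/

/-- `A` is diagonalized by the projections `P n`, with eigenvalues `s n`, where the index `n` is
allowed to have `s n = 0` only if `P n = 0`. -/
structure IsDiagonalizedBy (A : H →L[ℂ] H) (s : ℕ → ℂ) (P : ℕ → H →L[ℂ] H) : Prop where
  isStarProjection : ∀ n, IsStarProjection (P n)
  hasSum_id : ∀ x, HasSum (fun n => P n x) x
  proj_apply : ∀ n x, P n (A x) = s n • P n x
  proj_eq_zero : ∀ n, s n = 0 → P n = 0

namespace IsDiagonalizedBy

variable {A : H →L[ℂ] H} {s : ℕ → ℂ} {P : ℕ → H →L[ℂ] H}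

theorem inner_proj (h : IsDiagonalizedBy A s P) (n : ℕ) (x y : H) :
    inner ℂ (P n x) y = inner ℂ x (P n y) := by
  have := (h.isStarProjection n).isSelfAdjoint.adjoint_eq
  rw [← ContinuousLinearMap.adjoint_inner_right, this]

theorem proj_proj (h : IsDiagonalizedBy A s P) (n : ℕ) (x : H) : P n (P n x) = P n x :=
  congrArg (fun T : H →L[ℂ] H => T x) (h.isStarProjection n).isIdempotentElem

theorem hasSum_inner (h : IsDiagonalizedBy A s P) (g x : H) :
    HasSum (fun n => inner ℂ g (P n x)) (inner ℂ g x) :=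
  (innerSL ℂ g).hasSum (h.hasSum_id x)

theorem summable_norm_sq (h : IsDiagonalizedBy A s P) (x : H) :
    Summable fun n => ‖P n x‖ ^ 2 := by
  have h1 := (Complex.reCLM.hasSum (h.hasSum_inner x x)).summable
  refine h1.congr fun n => ?_
  have h2 : inner ℂ x (P n x) = inner ℂ (P n x) (P n x) := by rw [h.inner_proj, h.proj_proj]
  rw [h2, inner_self_eq_norm_sq_to_K, Complex.reCLM_apply]
  norm_cast

/-- Matrix elements of the resolution of the identity are absolutely summable. -/
theorem summable_norm_inner (h : IsDiagonalizedBy A s P) (g x : H) :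
    Summable fun n => ‖inner ℂ g (P n x)‖ := by
  refine Summable.of_nonneg_of_le (fun _ => norm_nonneg _) (fun n => ?_)
    ((h.summable_norm_sq g).add (h.summable_norm_sq x))
  have h1 : inner ℂ g (P n x) = inner ℂ (P n g) (P n x) := by rw [h.inner_proj, h.proj_proj]
  rw [h1]
  refine (norm_inner_le_norm _ _).trans ?_
  nlinarith [sq_nonneg (‖P n g‖ - ‖P n x‖), sq_nonneg (‖P n g‖ + ‖P n x‖)]

theorem eq_zero_of_proj (h : IsDiagonalizedBy A s P) {x : H} (hx : ∀ n, P n x = 0) : x = 0 := by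
  have h1 := h.hasSum_id x
  simp only [hx] at h1
  exact h1.unique hasSum_zero

theorem eq_zero_of_apply_eq_zero (h : IsDiagonalizedBy A s P) {x : H} (hx : A x = 0) : x = 0 := by
  refine h.eq_zero_of_proj fun n => ?_
  have h1 := h.proj_apply n x
  rw [hx, map_zero] at h1
  rcases smul_eq_zero.1 h1.symm with h0 | h0
  · rw [h.proj_eq_zero n h0]; rfl
  · exact h0

end IsDiagonalizedBy

/-! ### Quasinilpotent parts of one-dimensional perturbations -/

theorem summable_div_one_sub {s c : ℕ → ℂ} (hs0 : Tendsto s atTop (𝓝 0))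
    (hc : Summable fun n => ‖c n‖) (w : ℂ) : Summable fun n => c n / (1 - w * s n) := by
  have h1 : Tendsto (fun n => ‖1 - w * s n‖) atTop (𝓝 1) := by
    simpa using ((hs0.const_mul w).const_sub 1).norm
  refine Summable.of_norm_bounded_eventually_nat (hc.mul_left 2) ?_
  filter_upwards [h1.eventually_const_lt (show (1 / 2 : ℝ) < 1 by norm_num)] with n hn
  rw [norm_div, div_le_iff₀ (by linarith)]
  nlinarith [norm_nonneg (c n)]

omit [CompleteSpace H] in
@[simp]
theorem rankOnePerturbation_apply (A : H →L[ℂ] H) (a b x : H) :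
    rankOnePerturbation A a b x = A x + (inner ℂ b x : ℂ) • a := by
  simp [rankOnePerturbation]

namespace IsDiagonalizedBy

variable {A : H →L[ℂ] H} {s : ℕ → ℂ} {P : ℕ → H →L[ℂ] H}

/-- Matrix elements of the resolvent of `A` as Cauchy-type series: the solution `y` of
`(1 - w (A + ⟨·, b⟩ a)) y = h` is `(1 - w A)⁻¹ (h + w ⟨y, b⟩ a)`. -/
theorem inner_eq_cauchySeries (hD : IsDiagonalizedBy A s P) (hs0 : Tendsto s atTop (𝓝 0))
    {a b h y : H} {w : ℂ} (hy : y - w • rankOnePerturbation A a b y = h)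
    (hw : ∀ n, 1 - w * s n ≠ 0) (g : H) :
    inner ℂ g y = cauchySeries s (fun n => inner ℂ g (P n h)) w +
      w * inner ℂ b y * cauchySeries s (fun n => inner ℂ g (P n a)) w := by
  have hn (n : ℕ) : inner ℂ g (P n y) = inner ℂ g (P n h) / (1 - w * s n) +
      w * inner ℂ b y * (inner ℂ g (P n a) / (1 - w * s n)) := by
    have h1 := congrArg (fun x => inner ℂ g (P n x)) hy
    simp only [rankOnePerturbation_apply, map_sub, map_smul, map_add, hD.proj_apply,
      inner_sub_right, inner_add_right, inner_smul_right] at h1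
    have := hw n
    field_simp
    linear_combination h1
  have h1 := (hD.hasSum_inner g y).tsum_eq
  rw [← h1, tsum_congr hn, Summable.tsum_add
    (summable_div_one_sub hs0 (hD.summable_norm_inner g h) w)
    ((summable_div_one_sub hs0 (hD.summable_norm_inner g a) w).mul_left _), tsum_mul_left]
  rfl

/-- The scalar form of the resolvent identity for a one-dimensional perturbation. -/
theorem inner_mul_perturbationDet (hD : IsDiagonalizedBy A s P) (hs0 : Tendsto s atTop (𝓝 0))
    {a b h y : H} {w : ℂ} (hy : y - w • rankOnePerturbation A a b y = h)
    (hw : ∀ n, 1 - w * s n ≠ 0) (g : H) :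
    inner ℂ g y * perturbationDet s (fun n => inner ℂ b (P n a)) w =
      cauchySeries s (fun n => inner ℂ g (P n h)) w *
        perturbationDet s (fun n => inner ℂ b (P n a)) w +
      w * (cauchySeries s (fun n => inner ℂ b (P n h)) w *
        cauchySeries s (fun n => inner ℂ g (P n a)) w) := by
  have h1 := hD.inner_eq_cauchySeries hs0 hy hw g
  have h2 := hD.inner_eq_cauchySeries hs0 hy hw b
  rw [perturbationDet]
  rw [h1]
  linear_combination w * cauchySeries s (fun n => inner ℂ g (P n a)) w * h2

end IsDiagonalizedBy

/-- A nilpotent operator with finite-dimensional kernel acts on a finite-dimensional space. -/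
theorem Module.End.finiteDimensional_of_pow_eq_zero {V : Type*} [AddCommGroup V] [Module ℂ V]
    (f : Module.End ℂ V) (hker : FiniteDimensional ℂ (LinearMap.ker f)) {n : ℕ} (hn : f ^ n = 0) :
    FiniteDimensional ℂ V := by
  have key (i : ℕ) : (LinearMap.ker (f ^ i)).FG := by
    induction i with
    | zero => rw [pow_zero, Module.End.one_eq_id, LinearMap.ker_id]; exact Submodule.fg_bot
    | succ i ih =>
      refine Submodule.fg_of_fg_map_of_fg_inf_ker f ?_ ?_
      · have hle : (LinearMap.ker (f ^ (i + 1))).map f ≤ LinearMap.ker (f ^ i) := by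
          rintro _ ⟨x, hx, rfl⟩
          rw [SetLike.mem_coe, LinearMap.mem_ker, pow_succ, Module.End.mul_apply] at hx
          exact hx
        have : FiniteDimensional ℂ (LinearMap.ker (f ^ i)) := Module.Finite.iff_fg.2 ih
        exact Module.Finite.iff_fg.1 (Submodule.finiteDimensional_of_le hle)
      · exact Module.Finite.iff_fg.1 (Submodule.finiteDimensional_of_le inf_le_right)
  have h1 := key n
  rw [hn, LinearMap.ker_zero] at h1
  exact ⟨h1⟩

/-- Invariant subspaces of the perturbed operator `T = A + ⟨·, b⟩ a` on which it is quasinilpotent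
are finite-dimensional. The subspace is given by an injection `J` intertwining `Q` with `T`. The
matrix elements of `(1 - w T)⁻¹ T ^ N` on such a subspace are entire functions of finite order
which, for `N = j + 1`, are bounded on almost all rays; hence they are constant, and `T` is
nilpotent there. -/
theorem IsDiagonalizedBy.finiteDimensional_of_quasinilpotent {A : H →L[ℂ] H} {s : ℕ → ℂ}
    {P : ℕ → H →L[ℂ] H} (hD : IsDiagonalizedBy A s P) (hs0 : Tendsto s atTop (𝓝 0))
    {m : ℕ} {α : Fin m → ℝ} (hs : ∀ n, s n ≠ 0 → ∃ l, s n ∈ closedRay (α l))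
    {p : ℝ} (hp : 0 < p) (hsp : Summable fun n => ‖s n‖ ^ p) {a b : H} {k : ℕ} (hk : 1 ≤ k)
    (hsum : Summable fun n => ‖s n‖ ^ (-(k : ℤ)) * ‖inner ℂ b (P n a)‖)
    (hM : ¬ MomentEquation s P a b k) {K : Type*} [NormedAddCommGroup K]
    [NormedSpace ℂ K] [CompleteSpace K] (J : K →L[ℂ] H) (hJ : Function.Injective J) (Q : K →L[ℂ] K)
    (hQ : ∀ x, J (Q x) = rankOnePerturbation A a b (J x)) (hunit : ∀ w : ℂ, IsUnit (1 - w • Q)) :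
    FiniteDimensional ℂ K := by
  have hd0 (n : ℕ) (h0 : s n = 0) : (inner ℂ b (P n a) : ℂ) = 0 := by simp [hD.proj_eq_zero n h0]
  obtain ⟨j, c, hc, hdet⟩ := exists_tendsto_perturbationDet_div_pow hs0 hd0 hk hsum hM
  set R : ℂ → K →L[ℂ] K := fun w => Ring.inverse (1 - w • Q) with hR
  have hRd : Differentiable ℂ R := fun w => by
    have h1 : DifferentiableAt ℂ Ring.inverse (1 - w • Q) := differentiableAt_inverse (hunit w)
    have h2 : DifferentiableAt ℂ (fun w : ℂ => 1 - w • Q) w :=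
      (differentiableAt_const _).sub (differentiableAt_id.smul_const Q)
    exact DifferentiableAt.comp w h1 h2
  have hRmul (w : ℂ) : (1 - w • Q) * R w = 1 := Ring.mul_inverse_cancel _ (hunit w)
  have hmulR (w : ℂ) : R w * (1 - w • Q) = 1 := Ring.inverse_mul_cancel _ (hunit w)
  have hres (h : K) (w : ℂ) :
      J (R w h) - w • rankOnePerturbation A a b (J (R w h)) = J h := by
    have h1 : R w h - w • Q (R w h) = h := congrArg (fun T : K →L[ℂ] K => T h) (hRmul w)
    rw [← hQ, ← map_smul, ← map_sub, h1]
  have hFd (g : H) (h : K) : Differentiable ℂ fun w => (inner ℂ g (J (R w h)) : ℂ) := by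
    have h1 : Differentiable ℂ fun w => R w h :=
      fun w => (hRd w).clm_apply (differentiableAt_const h)
    exact ((innerSL ℂ g) ∘L J).differentiable.comp h1
  -- The geometric series identity `(1 - w Q)⁻¹ = ∑ i < N, (w Q) ^ i + w ^ N (1 - w Q)⁻¹ Q ^ N`.
  have hgeom (N : ℕ) (w : ℂ) (h : K) :
      R w h = (∑ i ∈ Finset.range N, w ^ i • (Q ^ i) h) + w ^ N • R w ((Q ^ N) h) := by
    have h1 : R w = (∑ i ∈ Finset.range N, (w • Q) ^ i) + R w * (w • Q) ^ N := by
      have h2 := congrArg (fun X => R w * X) (mul_neg_geom_sum (w • Q) N)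
      simp only [← mul_assoc, hmulR, one_mul, mul_sub, mul_one] at h2
      rw [h2]; abel
    have h3 := congrArg (fun T : K →L[ℂ] K => T h) h1
    have hpow (i : ℕ) : (w • Q) ^ i = w ^ i • Q ^ i := smul_pow w Q i
    simp only [hpow] at h3
    simpa [sum_apply] using h3
  have hconst (g : H) (h : K) (w : ℂ) : (inner ℂ g (J (R w ((Q ^ (j + 1)) h))) : ℂ) =
      inner ℂ g (J ((Q ^ (j + 1)) h)) := by
    obtain ⟨C, hC, hmean⟩ := exists_circleAverage_posLog_norm_le hs0 hs hp hsp
      (hD.summable_norm_inner g (J ((Q ^ (j + 1)) h)))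
      (hD.summable_norm_inner b (J ((Q ^ (j + 1)) h))) (hD.summable_norm_inner g a)
      (hD.summable_norm_inner b a) (hFd g ((Q ^ (j + 1)) h))
      fun w hw => hD.inner_mul_perturbationDet hs0 (hres _ w) hw g
    have h1 := (hFd g ((Q ^ (j + 1)) h)).eq_const_of_bounded_on_dense_rays
      (C := 4 * C) (q := p + 1) (by positivity) (by positivity) (fun z hz => by
        rw [mul_assoc]
        exact (hFd g ((Q ^ (j + 1)) h)).norm_le_exp_of_circleAverage_posLog_le hC (by positivity)
          hmean hz) ?_ w
    · rw [h1]
      have : R 0 = 1 := by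
        have h2 := hRmul 0
        have h0 : (0 : ℂ) • Q = 0 := zero_smul ℂ Q
        rwa [h0, sub_zero, one_mul] at h2
      rw [this]; rfl
    · refine (dense_setOf_sinProd_pos α).mono fun θ hθ => ?_
      obtain ⟨M, R₀, hMR⟩ := exists_norm_le_pow_on_ray hs (hD.summable_norm_inner g (J h))
        (hD.summable_norm_inner b (J h)) (hD.summable_norm_inner g a)
        (fun w hw => hD.inner_mul_perturbationDet hs0 (hres h w) hw g) hc hdet hθ
      set F : ℂ → ℂ := fun w => inner ℂ g (J (R w ((Q ^ (j + 1)) h))) with hF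
      -- For small `ρ` the bound comes from compactness; for large `ρ` the geometric series identity
      -- turns the bound `M ρ ^ (j + 1)` into a constant.
      set r := max R₀ 1
      obtain ⟨M', hM'⟩ := (isCompact_Icc (a := (0 : ℝ)) (b := r)).exists_bound_of_continuousOn
        (f := fun ρ : ℝ => F (ρ * Complex.exp (θ * Complex.I)))
        ((hFd g ((Q ^ (j + 1)) h)).continuous.comp (by fun_prop)).continuousOn
      set S := ∑ i ∈ Finset.range (j + 1), ‖(inner ℂ g (J ((Q ^ i) h)) : ℂ)‖
      refine ⟨max M' (M + S), fun ρ hρ => ?_⟩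
      rcases le_or_gt ρ r with hle | hlt
      · exact (hM' ρ ⟨hρ, hle⟩).trans (le_max_left _ _)
      · refine le_trans ?_ (le_max_right _ _)
        have hρR : R₀ ≤ ρ := (le_max_left _ _).trans hlt.le
        have hρ1 : 1 ≤ ρ := (le_max_right _ _).trans hlt.le
        set w : ℂ := ρ * Complex.exp (θ * Complex.I)
        have hwn : ‖w‖ = ρ := by
          rw [norm_mul, Complex.norm_exp_ofReal_mul_I, Complex.norm_real,
            Real.norm_of_nonneg hρ, mul_one]
        have h2 : (inner ℂ g (J (R w h)) : ℂ) =
            (∑ i ∈ Finset.range (j + 1), w ^ i * inner ℂ g (J ((Q ^ i) h))) +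
              w ^ (j + 1) * F w := by
          rw [hgeom (j + 1) w h]
          simp [hF]
        have h3 : ρ ^ (j + 1) * ‖F w‖ ≤ ρ ^ (j + 1) * (M + S) := by
          calc ρ ^ (j + 1) * ‖F w‖ = ‖w ^ (j + 1) * F w‖ := by rw [norm_mul, norm_pow, hwn]
            _ = ‖(inner ℂ g (J (R w h)) : ℂ) -
                ∑ i ∈ Finset.range (j + 1), w ^ i * inner ℂ g (J ((Q ^ i) h))‖ := by
                rw [h2]; congr 1; ring
            _ ≤ M * ρ ^ (j + 1) +
                ∑ i ∈ Finset.range (j + 1), ρ ^ (j + 1) * ‖(inner ℂ g (J ((Q ^ i) h)) : ℂ)‖ := by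
                refine (norm_sub_le _ _).trans (add_le_add (hMR ρ hρR) ?_)
                refine (norm_sum_le _ _).trans (Finset.sum_le_sum fun i hi => ?_)
                rw [norm_mul, norm_pow, hwn]
                exact mul_le_mul_of_nonneg_right
                  (pow_le_pow_right₀ hρ1 (Finset.mem_range.1 hi).le) (norm_nonneg _)
            _ = ρ ^ (j + 1) * (M + S) := by rw [← Finset.mul_sum]; ring
        exact le_of_mul_le_mul_left h3 (by positivity)
  have hnil : (Q : Module.End ℂ K) ^ (j + 2) = 0 := by
    have h1 (h : K) : (Q ^ (j + 2)) h = 0 := by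
      have h2 : R 1 ((Q ^ (j + 1)) h) = (Q ^ (j + 1)) h := by
        exact hJ (ext_inner_left ℂ fun g => hconst g h 1)
      have h3 := congrArg (fun T : K →L[ℂ] K => T ((Q ^ (j + 1)) h)) (hRmul 1)
      have h4 : R 1 ((Q ^ (j + 1)) h) - (1 : ℂ) • Q (R 1 ((Q ^ (j + 1)) h)) = (Q ^ (j + 1)) h := h3
      rw [h2, one_smul, sub_eq_self] at h4
      rw [pow_succ']; exact h4
    ext h
    rw [← ContinuousLinearMap.toLinearMap_pow]
    exact h1 h
  refine Module.End.finiteDimensional_of_pow_eq_zero (Q : Module.End ℂ K) ?_ hnil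
  -- As `A` is injective, the functional `⟨·, b⟩` is injective on the kernel.
  refine Module.Finite.iff_fg.2 (Submodule.fg_of_fg_map_of_fg_inf_ker
    ((innerSL ℂ b ∘L J : K →L[ℂ] ℂ) : K →ₗ[ℂ] ℂ) ?_ ?_)
  · exact IsNoetherian.noetherian _
  · convert Submodule.fg_bot
    refine (Submodule.eq_bot_iff _).2 fun x hx => hJ ?_
    have h1 : Q x = 0 := hx.1
    have h2 : (inner ℂ b (J x) : ℂ) = 0 := hx.2
    have h3 := hQ x
    rw [h1, map_zero, rankOnePerturbation_apply, h2, zero_smul, add_zero] at h3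
    rw [map_zero]
    exact hD.eq_zero_of_apply_eq_zero h3.symm

/-! ### Spectral decompositions, Schatten classes and adjoints -/

open Classical in
/-- The eigenvalues `s n`, set to `0` for those indices whose projection vanishes. -/
def effectiveEigenvalue (s : ℕ → ℂ) (P : ℕ → H →L[ℂ] H) (n : ℕ) : ℂ := if P n = 0 then 0 else s n

namespace IsSpectralDecomposition

variable {A : H →L[ℂ] H} {s : ℕ → ℂ} {P : ℕ → H →L[ℂ] H}

theorem proj_apply (hA : IsSpectralDecomposition A s P) (n : ℕ) (x : H) :
    P n (A x) = s n • P n x := by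
  have h1 := (P n).hasSum (hA.hasSum_apply x)
  refine h1.unique ?_
  convert hasSum_single n fun m hm => ?_ using 1
  · have h2 := congrArg (fun T : H →L[ℂ] H => T x) (hA.isStarProjection n).isIdempotentElem
    change P n (P n x) = P n x at h2
    rw [map_smul, h2]
  · have h2 := congrArg (fun T : H →L[ℂ] H => T x) (hA.orthogonal n m hm.symm)
    change P n (P m x) = 0 at h2
    rw [map_smul, h2, smul_zero]

theorem isDiagonalizedBy (hA : IsSpectralDecomposition A s P) :
    IsDiagonalizedBy A (effectiveEigenvalue s P) P where
  isStarProjection := hA.isStarProjection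
  hasSum_id := hA.hasSum_id
  proj_apply n x := by
    rw [hA.proj_apply, effectiveEigenvalue]
    split_ifs with h <;> simp [h]
  proj_eq_zero n h := by
    rw [effectiveEigenvalue] at h
    split_ifs at h with h0
    · exact h0
    · exact absurd h (hA.ne_zero n)

theorem tendsto_effectiveEigenvalue (hA : IsSpectralDecomposition A s P) :
    Tendsto (effectiveEigenvalue s P) atTop (𝓝 0) := by
  refine squeeze_zero_norm (fun n => ?_) (tendsto_zero_iff_norm_tendsto_zero.1 hA.tendsto_zero)
  rw [effectiveEigenvalue]
  split_ifs <;> simp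

end IsSpectralDecomposition

namespace IsDiagonalizedBy

variable {A : H →L[ℂ] H} {s : ℕ → ℂ} {P : ℕ → H →L[ℂ] H}

theorem adjoint_apply_proj (hD : IsDiagonalizedBy A s P) (n : ℕ) (x : H) :
    ContinuousLinearMap.adjoint A (P n x) = starRingEnd ℂ (s n) • P n x := by
  refine ext_inner_left ℂ fun u => ?_
  rw [ContinuousLinearMap.adjoint_inner_right, ← hD.inner_proj, hD.proj_apply, inner_smul_left,
    inner_smul_right, hD.inner_proj]

end IsDiagonalizedBy

namespace IsSpectralDecomposition

variable {A : H →L[ℂ] H} {s : ℕ → ℂ} {P : ℕ → H →L[ℂ] H}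

theorem apply_proj (hA : IsSpectralDecomposition A s P) (n : ℕ) (x : H) :
    A (P n x) = s n • P n x := by
  refine (hA.hasSum_apply (P n x)).unique ?_
  convert hasSum_single n fun m hm => ?_ using 1
  · have h2 := congrArg (fun T : H →L[ℂ] H => T x) (hA.isStarProjection n).isIdempotentElem
    change P n (P n x) = P n x at h2
    rw [h2]
  · have h2 := congrArg (fun T : H →L[ℂ] H => T x) (hA.orthogonal m n hm)
    change P m (P n x) = 0 at h2
    rw [h2, smul_zero]

/-- The adjoint of `A` is diagonalized by the same projections. -/
theorem isDiagonalizedBy_adjoint (hA : IsSpectralDecomposition A s P) :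
    IsDiagonalizedBy (ContinuousLinearMap.adjoint A)
      (fun n => starRingEnd ℂ (effectiveEigenvalue s P n)) P where
  isStarProjection := hA.isStarProjection
  hasSum_id := hA.hasSum_id
  proj_apply n x := by
    refine ext_inner_left ℂ fun u => ?_
    have h1 : A (P n u) = effectiveEigenvalue s P n • P n u := by
      rw [hA.apply_proj, effectiveEigenvalue]
      split_ifs with h <;> simp [h]
    rw [← hA.isDiagonalizedBy.inner_proj, ContinuousLinearMap.adjoint_inner_right, h1,
      inner_smul_left, inner_smul_right, hA.isDiagonalizedBy.inner_proj]
  proj_eq_zero n h := hA.isDiagonalizedBy.proj_eq_zero n (by simpa using h)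

/-- The eigenvalues of `A` lie on the rays containing its spectrum. -/
theorem exists_mem_closedRay (hA : IsSpectralDecomposition A s P) {m : ℕ} {α : Fin m → ℝ}
    (hα : spectrum ℂ A ⊆ ⋃ l, closedRay (α l)) (n : ℕ) (hn : effectiveEigenvalue s P n ≠ 0) :
    ∃ l, effectiveEigenvalue s P n ∈ closedRay (α l) := by
  rw [effectiveEigenvalue] at hn ⊢
  split_ifs at hn ⊢ with h0
  · exact absurd rfl hn
  · obtain ⟨x, hx⟩ : ∃ x, P n x ≠ 0 := by
      by_contra! h
      exact h0 (ContinuousLinearMap.ext h)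
    have h1 : s n ∈ spectrum ℂ A := by
      rw [ContinuousLinearMap.spectrum_eq]
      refine Module.End.HasEigenvalue.mem_spectrum
        (Module.End.hasEigenvalue_of_hasEigenvector (x := P n x) ⟨?_, hx⟩)
      exact Module.End.mem_eigenspace_iff.2 (hA.apply_proj n x)
    exact Set.mem_iUnion.1 (hα h1)

/-- For a diagonalized operator in a Schatten class the moduli of the eigenvalues are `p`-summable:
the eigenvectors for eigenvalues of modulus `σ` are eigenvectors of `A† A` for `σ ^ 2`. -/
theorem summable_norm_rpow (hA : IsSpectralDecomposition A s P) {p : ℝ} (hp : 0 < p)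
    (hAp : MemSchatten p A) : Summable fun n => ‖effectiveEigenvalue s P n‖ ^ p := by
  classical
  set σ : ℕ → {σ : ℝ // 0 < σ} := fun n => ⟨‖s n‖, norm_pos_iff.2 (hA.ne_zero n)⟩ with hσ
  have hmult (I : Finset ℕ) (hI : ∀ n ∈ I, P n ≠ 0) (τ : {σ : ℝ // 0 < σ})
      (hτ : ∀ n ∈ I, σ n = τ) : I.card ≤ singularMultiplicity A τ := by
    have hex (n : I) : ∃ x, P n x ≠ 0 := by
      by_contra! h
      exact hI n n.2 (ContinuousLinearMap.ext h)
    choose x hx using hex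
    set C : H →L[ℂ] H := ContinuousLinearMap.adjoint A ∘L A with hC
    have hCc : IsCompactOperator C := hAp.1.clm_comp (ContinuousLinearMap.adjoint A)
    have hτ0 : ((τ : ℝ) : ℂ) ^ 2 ≠ 0 := pow_ne_zero _ (by exact_mod_cast τ.2.ne')
    have hfin : FiniteDimensional ℂ
        (Module.End.eigenspace (C : H →ₗ[ℂ] H) (((τ : ℝ) : ℂ) ^ 2)) :=
      ContinuousLinearMap.finite_dimensional_eigenspace hCc _ hτ0
    have hmem (n : I) : P n (x n) ∈ Module.End.eigenspace (C : H →ₗ[ℂ] H) (((τ : ℝ) : ℂ) ^ 2) := by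
      refine Module.End.mem_eigenspace_iff.2 ?_
      have h1 : effectiveEigenvalue s P n = s n := if_neg (hI n n.2)
      have h2 : ‖s n‖ = τ := congrArg Subtype.val (hτ n n.2)
      change ContinuousLinearMap.adjoint A (A (P n (x n))) = _
      rw [hA.apply_proj, map_smul, hA.isDiagonalizedBy.adjoint_apply_proj, h1, smul_smul,
        Complex.mul_conj, Complex.normSq_eq_norm_sq, h2]
      push_cast; rfl
    have hli : LinearIndependent ℂ fun n : I => P n (x n) := by
      refine linearIndependent_of_ne_zero_of_inner_eq_zero hx fun i k hik => ?_
      have h1 := congrArg (fun T : H →L[ℂ] H => T (x k))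
        (hA.orthogonal i k fun h => hik (Subtype.ext h))
      change P i (P k (x k)) = 0 at h1
      change inner ℂ (P i (x i)) (P k (x k)) = 0
      rw [hA.isDiagonalizedBy.inner_proj, h1, inner_zero_right]
    have hli' : LinearIndependent ℂ fun n : I =>
        (⟨P n (x n), hmem n⟩ : Module.End.eigenspace (C : H →ₗ[ℂ] H) (((τ : ℝ) : ℂ) ^ 2)) :=
      LinearIndependent.of_comp (Submodule.subtype _) hli
    have h1 := hli'.fintype_card_le_finrank
    rwa [Fintype.card_coe] at h1
  refine summable_of_sum_le (fun _ => by positivity) (c := ∑' σ : {σ : ℝ // 0 < σ},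
    (singularMultiplicity A σ : ℝ) * (σ : ℝ) ^ p) fun I => ?_
  set J := I.filter fun n => P n ≠ 0 with hJ
  calc ∑ n ∈ I, ‖effectiveEigenvalue s P n‖ ^ p = ∑ n ∈ J, ((σ n : ℝ)) ^ p := by
        rw [hJ, Finset.sum_filter]
        refine Finset.sum_congr rfl fun n _ => ?_
        by_cases h : P n = 0
        · simp [effectiveEigenvalue, h, Real.zero_rpow hp.ne']
        · simp [effectiveEigenvalue, h, hσ]
    _ = ∑ τ ∈ J.image σ, (J.filter fun n => σ n = τ).card • ((τ : ℝ) ^ p) :=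
        Finset.sum_comp (fun τ : {σ : ℝ // 0 < σ} => (τ : ℝ) ^ p) σ
    _ ≤ ∑ τ ∈ J.image σ, (singularMultiplicity A τ : ℝ) * (τ : ℝ) ^ p := by
        refine Finset.sum_le_sum fun τ _ => ?_
        rw [nsmul_eq_mul]
        have h1 := hmult (J.filter fun n => σ n = τ)
          (fun n hn => (Finset.mem_filter.1 (Finset.mem_filter.1 hn).1).2) τ
          fun n hn => (Finset.mem_filter.1 hn).2
        have := τ.2
        gcongr
    _ ≤ _ := hAp.2.sum_le_tsum _ fun τ _ => by
        have := τ.2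
        positivity

end IsSpectralDecomposition

/-! ### Location of the spectrum -/

/-- Points outside the angle of half-opening `ε` about a ray are far from the ray, in proportion to
their modulus. -/
theorem sin_mul_norm_le_norm_sub {α ε : ℝ} (hε : 0 < ε) {t z : ℂ}
    (ht : t ∈ closedRay α) (hz0 : z ≠ 0) (hz : z ∉ openAngle α ε) :
    Real.sin ε * ‖z‖ ≤ ‖t - z‖ := by
  obtain ⟨τ, hτ, rfl⟩ := ht
  set E := Complex.exp (α * Complex.I) with hE
  have hEn : ‖E‖ = 1 := Complex.norm_exp_ofReal_mul_I α
  have hE0 : E ≠ 0 := Complex.exp_ne_zero _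
  set ψ := Complex.arg (z / E) with hψ
  set ρ := ‖z‖ with hρ
  have hρ0 : 0 < ρ := norm_pos_iff.2 hz0
  have hzE : z / E = ρ * Complex.exp (ψ * Complex.I) := by
    have := Complex.norm_mul_exp_arg_mul_I (z / E)
    rw [norm_div, hEn, div_one] at this
    exact this.symm
  have hzψ : z = ρ * Complex.exp ((α + ψ : ℝ) * Complex.I) := by
    rw [div_eq_iff hE0] at hzE
    rw [hzE]; push_cast
    rw [add_mul, Complex.exp_add]; ring
  have hψε : ε ≤ |ψ| := by
    by_contra! hlt
    rw [abs_lt] at hlt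
    exact hz ⟨ρ, α + ψ, hρ0, by linarith, by linarith, hzψ⟩
  have hcos : Real.cos ψ ≤ Real.cos ε := by
    rw [← Real.cos_abs ψ]
    exact Real.cos_le_cos_of_nonneg_of_le_pi hε.le (Complex.abs_arg_le_pi _) hψε
  have h1 : ‖τ * E - z‖ = ‖(τ : ℂ) - ρ * Complex.exp (ψ * Complex.I)‖ := by
    rw [← hzE]
    have : (τ : ℂ) - z / E = (τ * E - z) / E := by field_simp
    rw [this, norm_div, hEn, div_one]
  have h2 : ‖(τ : ℂ) - ρ * Complex.exp (ψ * Complex.I)‖ ^ 2 =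
      τ ^ 2 - 2 * τ * ρ * Real.cos ψ + ρ ^ 2 := by
    rw [Complex.sq_norm, Complex.normSq_apply]
    simp only [Complex.sub_re, Complex.sub_im, Complex.ofReal_re, Complex.ofReal_im,
      Complex.re_ofReal_mul, Complex.im_ofReal_mul, Complex.exp_ofReal_mul_I_re,
      Complex.exp_ofReal_mul_I_im]
    linear_combination ρ ^ 2 * Real.sin_sq_add_cos_sq ψ
  rw [h1]
  refine le_of_sq_le_sq ?_ (norm_nonneg _)
  rw [h2]
  have h3 : τ * ρ * Real.cos ψ ≤ τ * ρ * Real.cos ε := by gcongr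
  have h4 := Real.sin_sq_add_cos_sq ε
  have h5 : (Real.sin ε * ρ) ^ 2 = ρ ^ 2 - (ρ * Real.cos ε) ^ 2 := by
    linear_combination ρ ^ 2 * h4
  rw [h5]
  nlinarith [sq_nonneg (τ - ρ * Real.cos ε)]

/-- A non-zero number away from the zeros of the perturbation determinant and from the eigenvalues
of `A` is not an eigenvalue of the perturbed operator. -/
theorem IsDiagonalizedBy.eq_zero_of_apply_eq_smul {A : H →L[ℂ] H} {s : ℕ → ℂ}
    {P : ℕ → H →L[ℂ] H} (hD : IsDiagonalizedBy A s P) (hs0 : Tendsto s atTop (𝓝 0)) {a b x : H}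
    {z : ℂ} (hz : z ≠ 0) (hsz : ∀ n, s n ≠ z)
    (hdet : 1 + ∑' n, (inner ℂ b (P n a) : ℂ) / (s n - z) ≠ 0)
    (hx : rankOnePerturbation A a b x = z • x) : x = 0 := by
  have hw (n : ℕ) : 1 - z⁻¹ * s n ≠ 0 := fun h => hsz n (by
    have h1 := sub_eq_zero.1 h
    field_simp at h1
    exact h1.symm)
  have hy : x - z⁻¹ • rankOnePerturbation A a b x = 0 := by
    rw [hx, inv_smul_smul₀ hz, sub_self]
  have hc0 (g : H) : cauchySeries s (fun n => inner ℂ g (P n (0 : H))) z⁻¹ = 0 := by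
    simp [cauchySeries]
  have h1 := hD.inner_mul_perturbationDet hs0 hy hw b
  rw [hc0, zero_mul, zero_mul, mul_zero, add_zero,
    perturbationDet_eq (inv_ne_zero hz) hw, inv_inv] at h1
  have h2 : (inner ℂ b x : ℂ) = 0 := (mul_eq_zero.1 h1).resolve_right hdet
  refine ext_inner_left ℂ fun g => ?_
  have h3 := hD.inner_eq_cauchySeries hs0 hy hw g
  rw [h3, hc0, h2, mul_zero, zero_mul, add_zero, inner_zero_right]

omit [CompleteSpace H] in
theorem IsCompactOperator.rankOnePerturbation {A : H →L[ℂ] H} (hA : IsCompactOperator A)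
    (a b : H) : IsCompactOperator (rankOnePerturbation A a b) := by
  refine hA.add (g := (innerSL ℂ b).smulRight a) ?_
  exact (isCompactOperator_of_locallyCompactSpace_rng
    (ContinuousLinearMap.toSpanSingleton ℂ a)).comp_clm (innerSL ℂ b)

/-- The non-zero spectrum of the perturbed operator accumulates at `0` only along the rays. -/
theorem IsDiagonalizedBy.exists_spectrum_inter_ball_subset {A : H →L[ℂ] H} {s : ℕ → ℂ}
    {P : ℕ → H →L[ℂ] H} (hD : IsDiagonalizedBy A s P) (hs0 : Tendsto s atTop (𝓝 0))
    {m : ℕ} {α : Fin m → ℝ} (hs : ∀ n, s n ≠ 0 → ∃ l, s n ∈ closedRay (α l))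
    {a b : H} {k : ℕ} (hk : 1 ≤ k)
    (hsum : Summable fun n => ‖s n‖ ^ (-(k : ℤ)) * ‖inner ℂ b (P n a)‖)
    (hM : ¬ MomentEquation s P a b k) (hL : IsCompactOperator (rankOnePerturbation A a b))
    {ε : ℝ} (hε : 0 < ε) :
    ∃ r : ℝ, 0 < r ∧ (spectrum ℂ (rankOnePerturbation A a b) \ {0}) ∩ Metric.ball 0 r ⊆
      ⋃ l, openAngle (α l) ε := by
  have hd0 (n : ℕ) (h0 : s n = 0) : (inner ℂ b (P n a) : ℂ) = 0 := by simp [hD.proj_eq_zero n h0]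
  obtain ⟨j, c, hc, hdet⟩ := exists_tendsto_perturbationDet_div_pow hs0 hd0 hk hsum hM
  -- Shrinking the angles makes `sin` of the half-opening positive.
  set η := min ε 1 with hη
  have hη0 : 0 < η := lt_min hε one_pos
  have hsin : 0 < Real.sin η := Real.sin_pos_of_pos_of_lt_pi hη0
    ((min_le_right _ _).trans_lt (by linarith [Real.pi_gt_three]))
  set Z : Set ℂ := {z | z ≠ 0 ∧ ∀ l, z ∉ openAngle (α l) ε} with hZ
  have hfar (z : ℂ) (hz : z ∈ Z) (n : ℕ) (hn : s n ≠ 0) : Real.sin η * ‖z‖ ≤ ‖s n - z‖ := by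
    obtain ⟨l, hl⟩ := hs n hn
    refine sin_mul_norm_le_norm_sub hη0 hl hz.1 fun ⟨ρ, θ, h1, h2, h3, h4⟩ =>
      hz.2 l ⟨ρ, θ, h1, ?_, ?_, h4⟩ <;> linarith [min_le_left ε 1]
  have hlim := hdet Z (Real.sin η) hsin fun z hz => ⟨hz.1, hfar z hz⟩
  have hev := hlim.eventually_ne hc
  obtain ⟨r, hr, hball⟩ := Metric.mem_nhdsWithin_iff.1 hev
  refine ⟨r, hr, fun z ⟨⟨hzσ, hz0⟩, hzr⟩ => ?_⟩
  by_contra hnot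
  have hz0' : z ≠ 0 := hz0
  have hzZ : z ∈ Z := ⟨hz0', fun l hl => hnot (Set.mem_iUnion.2 ⟨l, hl⟩)⟩
  have hne : 1 + ∑' n, (inner ℂ b (P n a) : ℂ) / (s n - z) ≠ 0 := fun h0 =>
    hball ⟨hzr, hzZ⟩ (by rw [h0, zero_div])
  obtain ⟨x, hx⟩ := ((hL.hasEigenvalue_iff_mem_spectrum hz0').2 hzσ).exists_hasEigenvector
  refine hx.2 (hD.eq_zero_of_apply_eq_smul hs0 hz0' (fun n hn => ?_) hne hx.apply_eq_smul)
  have h1 := hfar z hzZ n (by rwa [hn])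
  rw [hn, sub_self, norm_zero] at h1
  exact absurd h1 (not_le.2 (mul_pos hsin (norm_pos_iff.2 hz0')))

/-! ### Near completeness -/

theorem adjoint_rankOnePerturbation (A : H →L[ℂ] H) (a b : H) :
    ContinuousLinearMap.adjoint (rankOnePerturbation A a b) =
      rankOnePerturbation (ContinuousLinearMap.adjoint A) b a := by
  refine ContinuousLinearMap.ext fun x => ext_inner_right ℂ fun y => ?_
  rw [ContinuousLinearMap.adjoint_inner_left, rankOnePerturbation_apply, rankOnePerturbation_apply,
    inner_add_right, inner_add_left, ContinuousLinearMap.adjoint_inner_left, inner_smul_right,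
    inner_smul_left, inner_conj_symm, mul_comm]

/-- Near completeness of a compact operator whose adjoint is a one-dimensional perturbation of a
diagonalized operator for which a moment equation fails. -/
theorem IsDiagonalizedBy.nearlyComplete {A T : H →L[ℂ] H} {s : ℕ → ℂ}
    {P : ℕ → H →L[ℂ] H} (hD : IsDiagonalizedBy A s P) (hs0 : Tendsto s atTop (𝓝 0))
    {m : ℕ} {α : Fin m → ℝ} (hs : ∀ n, s n ≠ 0 → ∃ l, s n ∈ closedRay (α l))
    {p : ℝ} (hp : 0 < p) (hsp : Summable fun n => ‖s n‖ ^ p) {a b : H} {k : ℕ} (hk : 1 ≤ k)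
    (hsum : Summable fun n => ‖s n‖ ^ (-(k : ℤ)) * ‖inner ℂ b (P n a)‖)
    (hM : ¬ MomentEquation s P a b k) (hT : IsCompactOperator T)
    (hadj : ContinuousLinearMap.adjoint T = _root_.rankOnePerturbation A a b) :
    NearlyComplete T := by
  refine nearlyComplete_of_finiteDimensional_orthogonal ?_
  refine hD.finiteDimensional_of_quasinilpotent hs0 hs hp hsp hk hsum hM (rootSpan T)ᗮ.subtypeL
    Subtype.val_injective ((ContinuousLinearMap.adjoint T).restrict
      (adjoint_apply_mem_rootSpan_orthogonal T)) (fun x => ?_)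
    hT.isUnit_one_sub_smul_restrict_adjoint
  rw [← hadj]; rfl

theorem conj_mem_closedRay {α : ℝ} {z : ℂ} (hz : z ∈ closedRay α) :
    starRingEnd ℂ z ∈ closedRay (-α) := by
  obtain ⟨ρ, hρ, rfl⟩ := hz
  refine ⟨ρ, hρ, ?_⟩
  rw [map_mul, Complex.conj_ofReal, ← Complex.exp_conj, map_mul, Complex.conj_ofReal,
    Complex.conj_I]
  push_cast; ring_nf

omit [CompleteSpace H] in
/-- Passing to the adjoint conjugates the moment equations. -/
theorem momentEquation_conj_iff {s : ℕ → ℂ} {P : ℕ → H →L[ℂ] H}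
    (hP : ∀ n x y, inner ℂ (P n x) y = inner ℂ x (P n y)) {a b : H} {k : ℕ} :
    MomentEquation (fun n => starRingEnd ℂ (s n)) P b a k ↔ MomentEquation s P a b k := by
  have h1 (n : ℕ) : starRingEnd ℂ (s n) ^ (-(k : ℤ)) * inner ℂ a (P n b) =
      starRingEnd ℂ (s n ^ (-(k : ℤ)) * inner ℂ b (P n a)) := by
    rw [map_mul, map_zpow₀, inner_conj_symm, hP]
  have h2 : (if k = 1 then -1 else 0 : ℂ) = starRingEnd ℂ (if k = 1 then -1 else 0) := by
    split_ifs <;> simp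
  simp only [MomentEquation, h1]
  conv_lhs => rw [h2]
  exact Complex.hasSum_conj'

omit [CompleteSpace H] in
theorem momentEquation_effectiveEigenvalue_iff {s : ℕ → ℂ} {P : ℕ → H →L[ℂ] H} {a b : H} {k : ℕ} :
    MomentEquation (effectiveEigenvalue s P) P a b k ↔ MomentEquation s P a b k := by
  refine iff_of_eq (congrArg (fun f => HasSum f _) (funext fun n => ?_))
  by_cases h : P n = 0 <;> simp [effectiveEigenvalue, h]

end

theorem mainTheorem4 {H : Type*} [NormedAddCommGroup H] [InnerProductSpace ℂ H] [CompleteSpace H]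
    (A : H →L[ℂ] H) (hN : IsStarNormal A)
    (s : ℕ → ℂ) (P : ℕ → H →L[ℂ] H) (hA : IsSpectralDecomposition A s P)
    (p : ℝ) (hp : 0 < p) (hAp : MemSchatten p A)
    (m : ℕ) (α : Fin m → ℝ) (hα : spectrum ℂ A ⊆ ⋃ l, closedRay (α l))
    (a b : H) (k : ℕ) (hk : 1 ≤ k)
    (hsum : Summable fun n => ‖s n‖ ^ (-(k : ℤ)) * ‖inner ℂ b (P n a)‖)
    (hM : ¬ MomentEquation s P a b k) :
    NearlyComplete (rankOnePerturbation A a b) ∧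
    NearlyComplete (ContinuousLinearMap.adjoint (rankOnePerturbation A a b)) ∧
    ∀ ε : ℝ, 0 < ε → ∃ r : ℝ, 0 < r ∧
      (spectrum ℂ (rankOnePerturbation A a b) \ {0}) ∩ Metric.ball 0 r ⊆
        ⋃ l, openAngle (α l) ε := by
  have hD := hA.isDiagonalizedBy
  have hs0 := hA.tendsto_effectiveEigenvalue
  have hs := hA.exists_mem_closedRay hα
  have hsp := hA.summable_norm_rpow hp hAp
  have hL : IsCompactOperator (rankOnePerturbation A a b) := hAp.1.rankOnePerturbation a b
  have hM' := momentEquation_effectiveEigenvalue_iff.not.2 hM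
  have hsum' : Summable fun n =>
      ‖effectiveEigenvalue s P n‖ ^ (-(k : ℤ)) * ‖inner ℂ b (P n a)‖ := by
    refine hsum.congr fun n => ?_
    by_cases h : P n = 0 <;> simp [effectiveEigenvalue, h]
  refine ⟨?_, ?_, fun ε hε => hD.exists_spectrum_inter_ball_subset hs0 hs hk hsum' hM' hL hε⟩
  · refine hA.isDiagonalizedBy_adjoint.nearlyComplete (α := fun l => -α l) ?_ (fun n hn => ?_) hp ?_
      hk ?_ ((momentEquation_conj_iff hD.inner_proj).not.2 hM') hL
      (adjoint_rankOnePerturbation A a b)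
    · have := (Complex.continuous_conj.tendsto 0).comp hs0
      rwa [map_zero] at this
    · obtain ⟨l, hl⟩ := hs n (by simpa using hn)
      exact ⟨l, conj_mem_closedRay hl⟩
    · simpa only [RCLike.norm_conj] using hsp
    · refine hsum'.congr fun n => ?_
      rw [RCLike.norm_conj, ← hD.inner_proj, norm_inner_symm]
  · exact hD.nearlyComplete hs0 hs hp hsp hk hsum' hM' hL.adjoint
      (ContinuousLinearMap.adjoint_adjoint _)
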